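/- Notation. For entire $f$ put $f^\sharp(z)=\overline{f(\bar z)}$. The Hermite--Biehler class $\mathcal{HB}$ consists of the entire functions $E$ with $|E^\sharp(z)|<|E(z)|$ for $\operatorname{Im} z>0$ and without real zeros. For $E\in\mathcal{HB}$, or $E$ a nonzero constant, $\mathcal H(E)$ is the space of entire $f$ with $f/E,\ f^\sharp/E\in H^2(\mathbb C_+)$, with norm $\|f\|_{\mathcal H(E)}=\|f/E\|_{L^2(\mathbb R)}$. A de Branges subspace of $\mathcal H(E)$ is a linear subspace $V$ such that $V=\mathcal H(F)$ for some $F\in\mathcal{HB}$, with $\|f\|_{\mathcal H(F)}=\|f\|_{\mathcal H(E)}$ for all $f\in V$; by convention the zero subspace also counts as a de Branges subspace in statement (d) below (but not in (iii)). Put $J=\begin{bmatrix}0&-1\\1&0\end{bmatrix}$. A Hamiltonian on an interval $I$ is a locally integrable function $H:I\to\mathrm{Sym}_2(\mathbb R)$ which is nonnegative definite almost everywhere and does not vanish identically on any subset of $I$ of positive measure. It is in the limit circle case at an endpoint if its trace is integrable near that endpoint. A nonempty open interval $(a,b)\subset I$ is indivisible of type $\theta$ if $[\cos\theta\ \ \sin\theta]\,J\,H(t)=0$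 for almost every $t\in(a,b)$; a point of $I$ is regular if it lies in no indivisible interval. A Hamiltonian $H$ on $(t_0,t_1]$ is a structure Hamiltonian of $E\in\mathcal{HB}$ if (i) it is in the limit circle case at $t_1$, and the locally absolutely continuous solution of $$\frac{d}{dt}\begin{bmatrix}A(t,z)\\B(t,z)\end{bmatrix}=zJH(t)\begin{bmatrix}A(t,z)\\B(t,z)\end{bmatrix},\qquad A(t_1,z)=\tfrac12\bigl(E(z)+E^\sharp(z)\bigr),\quad B(t_1,z)=\tfrac i2\bigl(E(z)-E^\sharp(z)\bigr)$$ satisfies: (ii) $A(t,\cdot)-iB(t,\cdot)\in\mathcal{HB}$ for all $t\in(t_0,t_1]$; (iii) the de Branges subspaces of $\mathcal H(E)$ are exactly the spaces $\mathcal H(A(t,\cdot)-iB(t,\cdot))$ with $t\in(t_0,t_1]$ regular; (iv) for every $z\in\mathbb C$, $$\frac{\overline{A(t,z)}B(t,z)-A(t,z)\overline{B(t,z)}}{\pi(z-\bar z)}\to0\quad\text{as } t\to t_0^+,$$ where for real $z$ the quotient is replaced by its limiting value $\bigl(A(t,z)\,\partial_zB(t,z)-\partial_zA(t,z)\,B(t,z)\bigr)/\pi$.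 Statement. Let $E_0(z)=z^3+2iz^2-z-i$, let $t_0=0$, $t_1=\tfrac12$, $t_2=\tfrac92$, $t_3=5$, and let $$H_0(t)=\begin{bmatrix}0&0\\0&1\end{bmatrix}\ \text{ for } t\in[0,\tfrac12)\cup[\tfrac92,5],\qquad H_0(t)=\begin{bmatrix}1&0\\0&0\end{bmatrix}\ \text{ for } t\in[\tfrac12,\tfrac92).$$ (a) $H_0$ is a Hamiltonian on $[0,5]$, in the limit circle case at both endpoints; $(0,\tfrac12)$ and $(\tfrac92,5)$ are indivisible of type $\pi/2$, $(\tfrac12,\tfrac92)$ is indivisible of type $0$, and the set of regular points of $[0,5]$ is $\{t_0,t_1,t_2,t_3\}$. (b) $E_0\in\mathcal{HB}$, and $H_0$, restricted to $(0,5]$, is a structure Hamiltonian of $E_0$. (c) The initial value problem $\frac{d}{dt}W(t,z)J=zW(t,z)H_0(t)$, $W(0,z)=I$, on $[0,5]$ has the unique solution $$W(t,z)=\begin{bmatrix}A(t,z)&B(t,z)\\C(t,z)&D(t,z)\end{bmatrix}=\begin{cases}\begin{bmatrix}1&0\\-tz&1\end{bmatrix},&0\le t<\tfrac12,\\[3mm]\begin{bmatrix}1&(t-\tfrac12)z\\-\tfrac12z&1+\tfrac14(1-2t)z^2\end{bmatrix},&\tfrac12\le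 t<\tfrac92,\\[3mm]\begin{bmatrix}1+(18-4t)z^2&4z\\(2t-9)z^3-(t-4)z&1-2z^2\end{bmatrix},&\tfrac92\le t\le5,\end{cases}$$ and at $t=5$ it equals $W_0(z)=\begin{bmatrix}1-2z^2&4z\\z^3-z&1-2z^2\end{bmatrix}$. (d) Let $E(t,z)=C(t,z)-iD(t,z)$, so that $E(t_0,z)=-i$, $E(t_1,z)=-\tfrac z2-i$, $E(t_2,z)=-\tfrac z2+i(2z^2-1)$ and $E(t_3,z)=E_0(z)$. The de Branges subspaces of $\mathcal H(E_0)$ (including the zero subspace) are exactly $\mathcal H(E(t_k,\cdot))$, $k=0,1,2,3$. The norm of each of them is the restriction of the norm of $\mathcal H(E_0)$, and $\dim\mathcal H(E(t_k,\cdot))=k$. -/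

import Mathlib

open MeasureTheory Set Filter Topology

namespace DeBranges

noncomputable section

/-- `E^♯(z) = conj (E (conj z))`. -/
def sharp (f : ℂ → ℂ) (z : ℂ) : ℂ := (starRingEnd ℂ) (f ((starRingEnd ℂ) z))

/-- The Hermite--Biehler class: entire functions `E` with `|E^♯| < |E|` on the open upper half-plane
and without real zeros. -/
structure IsHB (E : ℂ → ℂ) : Prop where
  entire : Differentiable ℂ E
  norm_lt : ∀ z : ℂ, 0 < z.im → ‖sharp E z‖ < ‖E z‖
  real_ne_zero : ∀ x : ℝ, E (x : ℂ) ≠ 0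

/-- Membership in the Hardy space `H²(ℂ₊)`; only the values of `f` on the open upper half-plane
matter. -/
def IsHardy (f : ℂ → ℂ) : Prop :=
  DifferentiableOn ℂ f {z : ℂ | 0 < z.im} ∧
    (⨆ (v : ℝ) (_ : 0 < v), ∫⁻ u : ℝ, ‖f ((u : ℂ) + (v : ℂ) * Complex.I)‖ₑ ^ 2) < ⊤

theorem isHardy_zero : IsHardy (fun _ => 0) := by
  refine ⟨differentiableOn_const _, ?_⟩
  simp

theorem IsHardy.smul {f : ℂ → ℂ} (hf : IsHardy f) (c : ℂ) : IsHardy (fun z => c * f z) := by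
  refine ⟨hf.1.const_mul c, ?_⟩
  refine lt_of_le_of_lt (b := ‖c‖ₑ ^ 2 *
    (⨆ (v : ℝ) (_ : 0 < v), ∫⁻ u : ℝ, ‖f ((u : ℂ) + (v : ℂ) * Complex.I)‖ₑ ^ 2)) ?_ ?_
  · refine iSup₂_le fun v hv => ?_
    have h : ∀ u : ℝ, ‖c * f ((u : ℂ) + (v : ℂ) * Complex.I)‖ₑ ^ 2
        = ‖c‖ₑ ^ 2 * ‖f ((u : ℂ) + (v : ℂ) * Complex.I)‖ₑ ^ 2 := fun u => by
      rw [enorm_mul, mul_pow]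
    simp_rw [h]
    rw [lintegral_const_mul' _ _ (by finiteness)]
    gcongr
    exact le_iSup₂_of_le v hv le_rfl
  · exact ENNReal.mul_lt_top (by finiteness) hf.2

theorem IsHardy.add {f g : ℂ → ℂ} (hf : IsHardy f) (hg : IsHardy g) :
    IsHardy (fun z => f z + g z) := by
  refine ⟨hf.1.add hg.1, ?_⟩
  refine lt_of_le_of_lt (b :=
    2 * (⨆ (v : ℝ) (_ : 0 < v), ∫⁻ u : ℝ, ‖f ((u : ℂ) + (v : ℂ) * Complex.I)‖ₑ ^ 2) +
    2 * (⨆ (v : ℝ) (_ : 0 < v), ∫⁻ u : ℝ, ‖g ((u : ℂ) + (v : ℂ) * Complex.I)‖ₑ ^ 2)) ?_ ?_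
  · refine iSup₂_le fun v hv => ?_
    have hline : Continuous fun u : ℝ => (u : ℂ) + (v : ℂ) * Complex.I := by fun_prop
    have hcont : Continuous fun u : ℝ => f ((u : ℂ) + (v : ℂ) * Complex.I) :=
      hf.1.continuousOn.comp_continuous hline fun u => by simpa using hv
    have hpt : ∀ u : ℝ, ‖f ((u : ℂ) + (v : ℂ) * Complex.I) + g ((u : ℂ) + (v : ℂ) * Complex.I)‖ₑ ^ 2
        ≤ 2 * ‖f ((u : ℂ) + (v : ℂ) * Complex.I)‖ₑ ^ 2
          + 2 * ‖g ((u : ℂ) + (v : ℂ) * Complex.I)‖ₑ ^ 2 := fun u => by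
      refine (pow_le_pow_left₀ (by positivity) (enorm_add_le _ _) 2).trans ?_
      rw [enorm_eq_nnnorm, enorm_eq_nnnorm]
      generalize ‖f ((u : ℂ) + (v : ℂ) * Complex.I)‖₊ = a
      generalize ‖g ((u : ℂ) + (v : ℂ) * Complex.I)‖₊ = b
      norm_cast
      rw [← NNReal.coe_le_coe]
      push_cast
      nlinarith [sq_nonneg ((a : ℝ) - b)]
    refine (lintegral_mono hpt).trans ?_
    rw [lintegral_add_left ((hcont.measurable.enorm.pow_const 2).const_mul 2), lintegral_const_mul' _ _ (by finiteness),
      lintegral_const_mul' _ _ (by finiteness)]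
    gcongr
    · exact le_iSup₂_of_le (f := fun (v : ℝ) (_ : 0 < v) =>
        ∫⁻ u : ℝ, ‖f ((u : ℂ) + (v : ℂ) * Complex.I)‖ₑ ^ 2) v hv le_rfl
    · exact le_iSup₂_of_le (f := fun (v : ℝ) (_ : 0 < v) =>
        ∫⁻ u : ℝ, ‖g ((u : ℂ) + (v : ℂ) * Complex.I)‖ₑ ^ 2) v hv le_rfl
  · exact ENNReal.add_lt_top.2 ⟨ENNReal.mul_lt_top (by finiteness) hf.2,
      ENNReal.mul_lt_top (by finiteness) hg.2⟩

/-- `𝓗(E)`, the entire `f` with `f / E` and `f^♯ / E` in `H²(ℂ₊)`. It is used for `E` in the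
Hermite--Biehler class and, in the degenerate case, for a nonzero constant `E`. -/
def deBrangesSpace (E : ℂ → ℂ) : Submodule ℂ (ℂ → ℂ) where
  carrier := {f | Differentiable ℂ f ∧ IsHardy (fun z => f z / E z) ∧
    IsHardy (fun z => sharp f z / E z)}
  zero_mem' := by
    refine ⟨differentiable_const _, ?_, ?_⟩
    · simpa using isHardy_zero
    · simpa [sharp] using isHardy_zero
  add_mem' := by
    rintro f g ⟨hf, hf1, hf2⟩ ⟨hg, hg1, hg2⟩
    refine ⟨hf.add hg, ?_, ?_⟩
    · simpa [add_div] using hf1.add hg1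
    · simpa [sharp, add_div] using hf2.add hg2
  smul_mem' := by
    rintro c f ⟨hf, hf1, hf2⟩
    refine ⟨hf.const_smul c, ?_, ?_⟩
    · simpa [mul_div_assoc] using hf1.smul c
    · simpa [sharp, mul_div_assoc] using hf2.smul ((starRingEnd ℂ) c)

/-- The norm of `𝓗(E)`: the `L²(ℝ)` norm of `f / E`. -/
def deBrangesNorm (E f : ℂ → ℂ) : ENNReal :=
  eLpNorm (fun x : ℝ => f (x : ℂ) / E (x : ℂ)) 2 volume

/-- `V` is a de Branges subspace of `𝓗(E)`: a subspace equal to `𝓗(F)`, with the same norm, for some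
`F` in the Hermite--Biehler class. -/
def IsDeBrangesSubspace (E : ℂ → ℂ) (V : Submodule ℂ (ℂ → ℂ)) : Prop :=
  V ≤ deBrangesSpace E ∧
    ∃ F : ℂ → ℂ, IsHB F ∧ V = deBrangesSpace F ∧ ∀ f ∈ V, deBrangesNorm F f = deBrangesNorm E f

/-- `A = (E + E^♯) / 2`. -/
def partA (E : ℂ → ℂ) (z : ℂ) : ℂ := (E z + sharp E z) / 2

/-- `B = (i / 2) (E - E^♯)`, so that `E = A - i B`. -/
def partB (E : ℂ → ℂ) (z : ℂ) : ℂ := Complex.I / 2 * (E z - sharp E z)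

open Classical in
/-- The diagonal `K(z, z)` of the reproducing kernel
`K(z, w) = (conj (A z) * B w - A w * conj (B z)) / (π (w - conj z))`; at a real point the quotient is
replaced by its limit. -/
def kernelDiag (A B : ℂ → ℂ) (z : ℂ) : ℂ :=
  if z.im = 0 then (A z * deriv B z - deriv A z * B z) / Real.pi
  else ((starRingEnd ℂ) (A z) * B z - A z * (starRingEnd ℂ) (B z)) /
    (Real.pi * (z - (starRingEnd ℂ) z))

/-- The matrix `J`. -/
def matJ (R : Type*) [CommRing R] : Matrix (Fin 2) (Fin 2) R := !![0, -1; 1, 0]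

/-- The real matrix `M` regarded as a complex matrix. -/
def toC (M : Matrix (Fin 2) (Fin 2) ℝ) : Matrix (Fin 2) (Fin 2) ℂ := M.map Complex.ofReal

/-- Hamiltonians on the interval `I`. -/
structure IsHamiltonian (H : ℝ → Matrix (Fin 2) (Fin 2) ℝ) (I : Set ℝ) : Prop where
  isSymm : ∀ t ∈ I, (H t).IsSymm
  nonneg : ∀ᵐ t ∂(volume.restrict I), (H t).PosSemidef
  ne_zero : ∀ S : Set ℝ, S ⊆ I → 0 < volume S → ∃ t ∈ S, H t ≠ 0
  locInt : ∀ i j : Fin 2, LocallyIntegrableOn (fun t => H t i j) I volume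

/-- Limit circle case at the left endpoint of an interval with endpoints `t₀ < t₁`. -/
def LimitCircleLeft (H : ℝ → Matrix (Fin 2) (Fin 2) ℝ) (t₀ t₁ : ℝ) : Prop :=
  ∃ t ∈ Ioo t₀ t₁, IntegrableOn (fun u => (H u).trace) (Ioo t₀ t) volume

/-- Limit circle case at the right endpoint of an interval with endpoints `t₀ < t₁`. -/
def LimitCircleRight (H : ℝ → Matrix (Fin 2) (Fin 2) ℝ) (t₀ t₁ : ℝ) : Prop :=
  ∃ t ∈ Ioo t₀ t₁, IntegrableOn (fun u => (H u).trace) (Ioo t t₁) volume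

/-- The open interval `(a, b) ⊆ I` is indivisible of type `θ`:
`[cos θ, sin θ] J H(t) = 0` for almost every `t` in it. -/
def IsIndivisible (H : ℝ → Matrix (Fin 2) (Fin 2) ℝ) (I : Set ℝ) (a b θ : ℝ) : Prop :=
  a < b ∧ Ioo a b ⊆ I ∧
    ∀ᵐ t ∂(volume.restrict (Ioo a b)),
      Matrix.vecMul ![Real.cos θ, Real.sin θ] (matJ ℝ * H t) = 0

/-- The regular points of `I`: those that are not inner points of an indivisible interval. -/
def regularPoints (H : ℝ → Matrix (Fin 2) (Fin 2) ℝ) (I : Set ℝ) : Set ℝ :=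
  {t ∈ I | ¬ ∃ a b θ : ℝ, IsIndivisible H I a b θ ∧ t ∈ Ioo a b}

/-- `X` is a (locally absolutely continuous) solution on the interval `I` of the canonical system
`X'(t) = z J H(t) X(t)`, in integrated form. -/
def IsCanonicalSolution (H : ℝ → Matrix (Fin 2) (Fin 2) ℝ) (I : Set ℝ) (z : ℂ)
    (X : ℝ → Fin 2 → ℂ) : Prop :=
  ContinuousOn X I ∧
    ∀ s ∈ I, ∀ t ∈ I,
      X t - X s = ∫ u in s..t, z • Matrix.mulVec (matJ ℂ * toC (H u)) (X u)

/-- `H` on `(t₀, t₁]` is a structure Hamiltonian of `E`. -/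
def IsStructureHamiltonian (E : ℂ → ℂ) (t₀ t₁ : ℝ) (H : ℝ → Matrix (Fin 2) (Fin 2) ℝ) : Prop :=
  t₀ < t₁ ∧ IsHamiltonian H (Ioc t₀ t₁) ∧ LimitCircleRight H t₀ t₁ ∧
  ∃ A B : ℝ → ℂ → ℂ,
    (∀ z : ℂ, IsCanonicalSolution H (Ioc t₀ t₁) z (fun t => ![A t z, B t z])) ∧
    (∀ z : ℂ, A t₁ z = partA E z ∧ B t₁ z = partB E z) ∧
    (∀ t ∈ Ioc t₀ t₁, IsHB (fun z => A t z - Complex.I * B t z)) ∧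
    (∀ V : Submodule ℂ (ℂ → ℂ), IsDeBrangesSubspace E V ↔
      ∃ t ∈ regularPoints H (Ioc t₀ t₁),
        V = deBrangesSpace (fun z => A t z - Complex.I * B t z)) ∧
    (∀ z : ℂ, Tendsto (fun t => kernelDiag (A t) (B t) z) (𝓝[>] t₀) (𝓝 0))

/-- `W` is a fundamental solution for `H` on the interval `I` with left endpoint `t₀ ∈ I`:
`(d/dt) W(t, z) J = z W(t, z) H(t)`, in integrated form, and `W(t₀, z)` is the identity matrix. -/
def IsFundamentalSolution (H : ℝ → Matrix (Fin 2) (Fin 2) ℝ) (I : Set ℝ) (t₀ : ℝ)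
    (W : ℝ → ℂ → Matrix (Fin 2) (Fin 2) ℂ) : Prop :=
  ∀ z : ℂ, W t₀ z = 1 ∧ ContinuousOn (fun t => W t z) I ∧
    ∀ s ∈ I, ∀ t ∈ I, ∀ i j : Fin 2,
      (W t z * matJ ℂ) i j - (W s z * matJ ℂ) i j = ∫ u in s..t, z * (W u z * toC (H u)) i j

/-- `E₀(z) = z³ + 2 i z² - z - i`. -/
def E₀ (z : ℂ) : ℂ := z ^ 3 + 2 * Complex.I * z ^ 2 - z - Complex.I

open Classical in
/-- The Hamiltonian `H₀`, considered on `[0, 5]`. -/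
def H₀ (t : ℝ) : Matrix (Fin 2) (Fin 2) ℝ :=
  if 1 / 2 ≤ t ∧ t < 9 / 2 then !![1, 0; 0, 0] else !![0, 0; 0, 1]

open Classical in
/-- The explicit matrix `W(t, z) = [A(t, z), B(t, z); C(t, z), D(t, z)]`, considered for
`t ∈ [0, 5]`. -/
def W₀ (t : ℝ) (z : ℂ) : Matrix (Fin 2) (Fin 2) ℂ :=
  if t < 1 / 2 then !![1, 0; -(t * z), 1]
  else if t < 9 / 2 then
    !![1, (t - 1 / 2) * z; -(1 / 2) * z, 1 + 1 / 4 * (1 - 2 * t) * z ^ 2]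
  else
    !![1 + (18 - 4 * t) * z ^ 2, 4 * z; (2 * t - 9) * z ^ 3 - (t - 4) * z, 1 - 2 * z ^ 2]

/-- `E(t, z) = C(t, z) - i D(t, z)`. -/
def Et (t : ℝ) (z : ℂ) : ℂ := W₀ t z 1 0 - Complex.I * W₀ t z 1 1

/-- `t₀ = 0`, `t₁ = 1/2`, `t₂ = 9/2`, `t₃ = 5`. -/
def tPt : Fin 4 → ℝ := ![0, 1 / 2, 9 / 2, 5]

end

end DeBranges

open DeBranges

namespace DeBranges

/-! The functions `Et (tPt k)` are polynomials of degree `k` without zeros in the closed upper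
half-plane. For any such polynomial `q`, the space of `q` consists exactly of the polynomials of
degree less than `deg q` (`deBrangesSpace_eval`). One inclusion is decay of `p / q`. For the other,
the Hardy bounds on `f / q` and `f^♯ / q` limit the mean square of `f` over large boxes, and hence
kill all its high Taylor coefficients.

A de Branges space is closed under division by zeros (`IsHB.mem_of_mul_sub_mem`) and is nonzero
(`IsHB.deBrangesSpace_ne_bot`). Inside the polynomials of degree less than 3, division by zeros
leaves only the spaces `polySpace k` (`exists_eq_polySpace`), so the subspaces are known as vector
spaces.

That these spaces do carry the norm of `𝓗(E₀)` is Cauchy's theorem: for neighbours `a`, `b` in the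
chain, `1/|a|² - 1/|b|²` on the real line is the real part of some `r / (a b)`, and `p p^♯ r / (a
b)` is holomorphic in the closed upper half-plane and decays quadratically, so its integral vanishes
(`deBrangesNorm_eval_eq`).

The differential equations are elementary: `H₀` is piecewise a constant rank one diagonal matrix, so
on each piece one column of the solution is constant and the other is affine in `t`. Positivity of
`Im (conj C * D)` in the upper half-plane gives the Hermite--Biehler property (`isHB_Et`). -/

/-! ### Hardy bounds, division by zeros, nontriviality of de Branges spaces. -/

theorem sharp_differentiable {f : ℂ → ℂ} (hf : Differentiable ℂ f) : Differentiable ℂ (sharp f) :=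
  fun z => by
    have h := (hf (starRingEnd ℂ z)).hasDerivAt.conj_conj
    rw [Complex.conj_conj] at h
    exact h.differentiableAt

theorem IsHB.ne_zero {F : ℂ → ℂ} (hF : IsHB F) {z : ℂ} (hz : 0 ≤ z.im) : F z ≠ 0 := by
  rcases hz.lt_or_eq with h | h
  · exact norm_pos_iff.1 ((norm_nonneg _).trans_lt (hF.norm_lt z h))
  · have := hF.real_ne_zero z.re
    rwa [show ((z.re : ℝ) : ℂ) = z from Complex.ext rfl h] at this

theorem one_add_sq_le_normSq {z : ℂ} (hz : 0 ≤ z.im) : 1 + z.re ^ 2 ≤ ‖z + Complex.I‖ ^ 2 := by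
  rw [← Complex.normSq_eq_norm_sq, Complex.normSq_apply]
  simp only [Complex.add_re, Complex.I_re, Complex.add_im, Complex.I_im]
  nlinarith

theorem one_le_norm_add_I {z : ℂ} (hz : 0 ≤ z.im) : 1 ≤ ‖z + Complex.I‖ := by
  have := one_add_sq_le_normSq hz
  nlinarith [norm_nonneg (z + Complex.I), sq_nonneg z.re]

/-- On every horizontal line the square is at most `C² / (1 + u²)`, whose integral does not depend
on the height. -/
theorem isHardy_of_bound {g : ℂ → ℂ} (hg : DifferentiableOn ℂ g {z : ℂ | 0 < z.im}) (C : ℝ)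
    (h : ∀ z : ℂ, 0 < z.im → ‖g z‖ * ‖z + Complex.I‖ ≤ C) : IsHardy g := by
  refine ⟨hg, ?_⟩
  have hint : Integrable (fun u : ℝ => C ^ 2 * (1 + u ^ 2)⁻¹) := integrable_inv_one_add_sq.const_mul _
  refine lt_of_le_of_lt (iSup₂_le fun v hv => lintegral_mono fun u => ?_)
    hint.lintegral_lt_top
  set z : ℂ := (u : ℂ) + (v : ℂ) * Complex.I with hz
  have him : 0 < z.im := by simpa [hz] using hv
  have hre : z.re = u := by simp [hz]
  have h1 := h z him
  have h2 := one_add_sq_le_normSq him.le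
  rw [hre] at h2
  rw [← ofReal_norm, ← ENNReal.ofReal_pow (norm_nonneg _)]
  refine ENNReal.ofReal_le_ofReal ?_
  rw [← div_eq_mul_inv, le_div_iff₀ (by positivity)]
  calc ‖g z‖ ^ 2 * (1 + u ^ 2) ≤ ‖g z‖ ^ 2 * ‖z + Complex.I‖ ^ 2 := by gcongr
    _ = (‖g z‖ * ‖z + Complex.I‖) ^ 2 := by ring
    _ ≤ C ^ 2 := by gcongr

/-- A function without zeros on the closed upper half-plane dominates a continuous one near `w`. -/
theorem exists_norm_div_le {g F : ℂ → ℂ} (hg : Continuous g) (hF : Continuous F)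
    (h0 : ∀ z : ℂ, 0 ≤ z.im → F z ≠ 0) (w : ℂ) :
    ∃ M : ℝ, ∀ z : ℂ, 0 ≤ z.im → ‖z - w‖ ≤ 1 → ‖g z / F z‖ ≤ M := by
  have hK : IsCompact (Metric.closedBall w 1 ∩ {z : ℂ | 0 ≤ z.im}) :=
    (isCompact_closedBall w 1).inter_right (isClosed_le continuous_const Complex.continuous_im)
  obtain ⟨M, hM⟩ := hK.exists_bound_of_continuousOn
    (hg.continuousOn.div hF.continuousOn fun z hz => h0 z hz.2)
  exact ⟨M, fun z h1 h2 => hM z ⟨by simpa [dist_eq_norm] using h2, h1⟩⟩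

/-- Where `|z - w| ≥ 1`, the factor `z - w` only enlarges the function. In the unit disc about `w`
the quotient is bounded by compactness, and the part of a line inside it projects into an interval
of length 2. -/
theorem isHardy_div_of_mul_sub {g F : ℂ → ℂ} (hg : Differentiable ℂ g) (hF : Differentiable ℂ F)
    (h0 : ∀ z : ℂ, 0 ≤ z.im → F z ≠ 0) (w : ℂ)
    (h : IsHardy fun z => (z - w) * g z / F z) : IsHardy fun z => g z / F z := by
  obtain ⟨M, hM⟩ := exists_norm_div_le hg.continuous hF.continuous h0 w
  refine ⟨hg.differentiableOn.div hF.differentiableOn fun z hz => h0 z (le_of_lt hz), ?_⟩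
  refine lt_of_le_of_lt (b :=
    (⨆ (v : ℝ) (_ : 0 < v), ∫⁻ u : ℝ,
      ‖((u : ℂ) + (v : ℂ) * Complex.I - w) * g ((u : ℂ) + (v : ℂ) * Complex.I) /
        F ((u : ℂ) + (v : ℂ) * Complex.I)‖ₑ ^ 2) +
    ENNReal.ofReal M ^ 2 * volume (Icc (w.re - 1) (w.re + 1))) ?_ ?_
  · refine iSup₂_le fun v hv => ?_
    have hpt : ∀ u : ℝ, ‖g ((u : ℂ) + (v : ℂ) * Complex.I) / F ((u : ℂ) + (v : ℂ) * Complex.I)‖ₑ ^ 2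
        ≤ ‖((u : ℂ) + (v : ℂ) * Complex.I - w) * g ((u : ℂ) + (v : ℂ) * Complex.I) /
            F ((u : ℂ) + (v : ℂ) * Complex.I)‖ₑ ^ 2
          + (Icc (w.re - 1) (w.re + 1)).indicator (fun _ => ENNReal.ofReal M ^ 2) u := fun u => by
      set z : ℂ := (u : ℂ) + (v : ℂ) * Complex.I with hz
      have him : 0 < z.im := by simpa [hz] using hv
      rcases le_total ‖z - w‖ 1 with hle | hle
      · have hre : |u - w.re| ≤ 1 := by
          have := (Complex.abs_re_le_norm (z - w)).trans hle
          simpa [hz] using this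
        rw [abs_le] at hre
        rw [indicator_of_mem (show u ∈ Icc (w.re - 1) (w.re + 1) from
          ⟨by linarith, by linarith⟩)]
        refine le_add_left ?_
        gcongr
        rw [← ofReal_norm]
        exact ENNReal.ofReal_le_ofReal (hM z him.le hle)
      · refine le_add_right ?_
        gcongr
        rw [← ofReal_norm, ← ofReal_norm, mul_div_assoc, norm_mul]
        refine ENNReal.ofReal_le_ofReal ?_
        nlinarith [norm_nonneg (g z / F z)]
    refine (lintegral_mono hpt).trans ?_
    rw [lintegral_add_right _ (measurable_const.indicator measurableSet_Icc),
      lintegral_indicator_const measurableSet_Icc]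
    gcongr
    exact le_iSup₂_of_le (f := fun (v : ℝ) (_ : 0 < v) => ∫⁻ u : ℝ,
      ‖((u : ℂ) + (v : ℂ) * Complex.I - w) * g ((u : ℂ) + (v : ℂ) * Complex.I) /
        F ((u : ℂ) + (v : ℂ) * Complex.I)‖ₑ ^ 2) v hv le_rfl
  · refine ENNReal.add_lt_top.2 ⟨h.2, ?_⟩
    rw [Real.volume_Icc]
    finiteness

theorem mem_deBrangesSpace {E f : ℂ → ℂ} : f ∈ deBrangesSpace E ↔ Differentiable ℂ f ∧
    IsHardy (fun z => f z / E z) ∧ IsHardy (fun z => sharp f z / E z) := Iff.rfl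

/-- De Branges spaces are closed under division by zeros. -/
theorem IsHB.mem_of_mul_sub_mem {F g : ℂ → ℂ} (hF : IsHB F) (hg : Differentiable ℂ g) (w : ℂ)
    (h : (fun z => (z - w) * g z) ∈ deBrangesSpace F) : g ∈ deBrangesSpace F := by
  obtain ⟨-, h1, h2⟩ := mem_deBrangesSpace.1 h
  refine mem_deBrangesSpace.2 ⟨hg, isHardy_div_of_mul_sub hg hF.entire (fun z => hF.ne_zero) w h1,
    isHardy_div_of_mul_sub (sharp_differentiable hg) hF.entire (fun z => hF.ne_zero)
      (starRingEnd ℂ w) ?_⟩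
  simpa [sharp] using h2

theorem IsHB.norm_sharp_le {F : ℂ → ℂ} (hF : IsHB F) {z : ℂ} (hz : 0 ≤ z.im) :
    ‖sharp F z‖ ≤ ‖F z‖ := by
  rcases hz.lt_or_eq with h | h
  · exact (hF.norm_lt z h).le
  · have : (starRingEnd ℂ) z = z := Complex.conj_eq_iff_im.2 h.symm
    simp [sharp, this]

/-- Up to a constant, the witness is the reproducing kernel at the point 0: the function `F(z)
conj(F(0)) - F^♯(z) F(0)` divided by `z`. If it vanished identically, then `|F(i)| = |F^♯(i)|`,
against the Hermite--Biehler inequality. -/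
theorem IsHB.deBrangesSpace_ne_bot {F : ℂ → ℂ} (hF : IsHB F) : deBrangesSpace F ≠ ⊥ := by
  set N : ℂ → ℂ := fun z => F z * (starRingEnd ℂ) (F 0) - sharp F z * F 0 with hN
  have hNd : Differentiable ℂ N :=
    (hF.entire.mul_const _).sub ((sharp_differentiable hF.entire).mul_const _)
  set G : ℂ → ℂ := dslope N 0 with hG
  have hGd : Differentiable ℂ G := by
    have := (Complex.differentiableOn_dslope (f := N) (s := univ) (c := 0) (by simp)).2
      hNd.differentiableOn
    exact differentiableOn_univ.1 this
  have hN0 : N 0 = 0 := by simp [hN, sharp]; ring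
  have hNG : ∀ z, N z = z * G z := fun z => by
    have := sub_smul_dslope N 0 z
    simpa [hN0] using this.symm
  have hF0 : F 0 ≠ 0 := hF.ne_zero (by simp)
  have hNs : sharp N = -N := by
    funext z
    simp [hN, sharp]
  -- By this antisymmetry the two Hardy conditions on `G` reduce to one.
  have hGs : sharp G = -G := by
    have hz : ∀ z : ℂ, z ≠ 0 → sharp G z = -G z := fun z hz => by
      have h1 : sharp N z = z * sharp G z := by simp [sharp, hNG]
      rw [hNs, Pi.neg_apply, hNG, ← mul_neg] at h1
      exact (mul_left_cancel₀ hz h1).symm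
    funext z
    have hcl : Dense {z : ℂ | z ≠ 0} := dense_compl_singleton 0
    exact congrFun (Continuous.ext_on hcl (sharp_differentiable hGd).continuous
      hGd.neg.continuous fun z h => hz z h) z
  have hH : IsHardy fun z => G z / F z := by
    obtain ⟨M, hM⟩ := exists_norm_div_le hGd.continuous hF.entire.continuous
      (fun z => hF.ne_zero) 0
    refine isHardy_of_bound (hGd.differentiableOn.div hF.entire.differentiableOn fun z hz =>
      -- In the unit disc `|z + i| ≤ 2`. Outside it `|z + i| ≤ 2 |z|` and `|z G(z)| ≤ 2 |F(0)|
      -- |F(z)|`, whence the 4.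
      hF.ne_zero (le_of_lt hz)) (max (M * 2) (4 * ‖F 0‖)) fun z hz => ?_
    have htri : ‖z + Complex.I‖ ≤ ‖z‖ + 1 := by simpa using norm_add_le z Complex.I
    rcases le_total ‖z‖ 1 with hle | hle
    · refine le_max_of_le_left ?_
      have hM' := hM z hz.le (by simpa using hle)
      exact mul_le_mul hM' (by linarith) (norm_nonneg _) ((norm_nonneg _).trans hM')
    · refine le_max_of_le_right ?_
      have hFz : 0 < ‖F z‖ := norm_pos_iff.2 (hF.ne_zero hz.le)
      have h1 : ‖z‖ * ‖G z‖ ≤ 2 * ‖F 0‖ * ‖F z‖ := by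
        rw [← norm_mul, ← hNG]
        calc ‖N z‖ ≤ ‖F z‖ * ‖F 0‖ + ‖sharp F z‖ * ‖F 0‖ := by
              refine (norm_sub_le _ _).trans ?_
              simp
          _ ≤ ‖F z‖ * ‖F 0‖ + ‖F z‖ * ‖F 0‖ := by
              gcongr
              exact hF.norm_sharp_le hz.le
          _ = _ := by ring
      rw [norm_div, div_mul_eq_mul_div, div_le_iff₀ hFz]
      nlinarith [norm_nonneg (G z)]
  intro hbot
  have hmem : G ∈ deBrangesSpace F := by
    refine mem_deBrangesSpace.2 ⟨hGd, hH, ?_⟩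
    have := hH.smul (-1)
    rw [hGs]
    simpa [neg_div] using this
  rw [hbot, Submodule.mem_bot] at hmem
  have h1 := hNG Complex.I
  rw [hmem] at h1
  simp only [hN, Pi.zero_apply, mul_zero, sub_eq_zero] at h1
  have h2 := congrArg norm h1
  simp only [norm_mul, RCLike.norm_conj] at h2
  exact (hF.norm_lt Complex.I (by simp)).ne
    (mul_right_cancel₀ (norm_ne_zero_iff.2 hF0) h2).symm

/-! ### Polynomial spaces closed under division by zeros. -/

open Polynomial in
/-- The polynomial functions of degree less than `n`. -/
noncomputable def polySpace (n : ℕ) : Submodule ℂ (ℂ → ℂ) :=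
  (degreeLT ℂ n).map (LinearMap.pi fun z => (leval z : ℂ[X] →ₗ[ℂ] ℂ))

theorem mem_polySpace {n : ℕ} {f : ℂ → ℂ} :
    f ∈ polySpace n ↔ ∃ p : Polynomial ℂ, p.degree < n ∧ (fun z => p.eval z) = f := by
  simp only [polySpace, Submodule.mem_map, Polynomial.mem_degreeLT]
  rfl

theorem finrank_polySpace (n : ℕ) :
    Module.Finite ℂ (polySpace n) ∧ Module.finrank ℂ (polySpace n) = n := by
  have hinj : Function.Injective
      (LinearMap.pi fun z => (Polynomial.leval z : Polynomial ℂ →ₗ[ℂ] ℂ)) := fun p q h =>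
    Polynomial.funext fun z => congrFun h z
  have e := (Polynomial.degreeLTEquiv ℂ n).symm.trans
    (Submodule.equivMapOfInjective _ hinj (Polynomial.degreeLT ℂ n))
  refine ⟨Module.Finite.equiv e, ?_⟩
  rw [← polySpace] at e
  rw [← e.finrank_eq, Module.finrank_fin_fun]

theorem polySpace_mono {m n : ℕ} (h : m ≤ n) : polySpace m ≤ polySpace n := by
  intro f hf
  obtain ⟨p, hp, rfl⟩ := mem_polySpace.1 hf
  exact mem_polySpace.2 ⟨p, hp.trans_le (by exact_mod_cast h), rfl⟩

/-- Dividing `p` by a linear factor gives an element of `V` of degree one less, so by induction `V`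
contains all lower degrees. A multiple of `p` then removes the leading coefficient of any polynomial
of the same degree. -/
theorem polySpace_succ_le {V : Submodule ℂ (ℂ → ℂ)}
    (hV : ∀ (g : ℂ → ℂ) (w : ℂ), Differentiable ℂ g → (fun z => (z - w) * g z) ∈ V → g ∈ V) (n : ℕ) :
    ∀ p : Polynomial ℂ, p ≠ 0 → p.natDegree = n → (fun z => p.eval z) ∈ V → polySpace (n + 1) ≤ V := by
  induction n with
  | zero =>
    intro p hp hn hpV f hf
    obtain ⟨q, hq, rfl⟩ := mem_polySpace.1 hf
    rw [Polynomial.natDegree_eq_zero] at hn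
    obtain ⟨c, rfl⟩ := hn
    have hc : c ≠ 0 := by rintro rfl; simp at hp
    have hq' : q.natDegree = 0 := by
      rcases eq_or_ne q 0 with rfl | h0
      · simp
      · have := (Polynomial.natDegree_lt_iff_degree_lt h0).2 hq
        omega
    obtain ⟨d, rfl⟩ := Polynomial.natDegree_eq_zero.1 hq'
    have := V.smul_mem (d / c) hpV
    convert this using 1
    funext z
    simp [hc]
  | succ n ih =>
    intro p hp hn hpV f hf
    obtain ⟨a, ha⟩ := IsAlgClosed.exists_root p (by
      rw [Polynomial.degree_eq_natDegree hp, hn]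
      exact_mod_cast Nat.succ_ne_zero n)
    obtain ⟨s, rfl⟩ := Polynomial.dvd_iff_isRoot.2 ha
    have hs0 : s ≠ 0 := right_ne_zero_of_mul hp
    have hsn : s.natDegree = n := by
      rw [Polynomial.natDegree_mul (Polynomial.X_sub_C_ne_zero a) hs0,
        Polynomial.natDegree_X_sub_C] at hn
      omega
    have hsV : polySpace (n + 1) ≤ V :=
      ih s hs0 hsn (hV _ a s.differentiable (by simpa using hpV))
    obtain ⟨q, hq, rfl⟩ := mem_polySpace.1 hf
    set p := (Polynomial.X - Polynomial.C a) * s with hpdef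
    have hl : p.coeff (n + 1) ≠ 0 := by
      rw [← hn]
      exact Polynomial.leadingCoeff_ne_zero.2 hp
    set c := q.coeff (n + 1) / p.coeff (n + 1) with hc
    have hr : (q - c • p).degree < (n + 1 : ℕ) := by
      rw [Polynomial.degree_lt_iff_coeff_zero]
      intro m hm
      rcases hm.eq_or_lt with rfl | hm
      · simp [hc, hl]
      · rw [Polynomial.coeff_sub, Polynomial.coeff_smul,
          Polynomial.coeff_eq_zero_of_natDegree_lt (by omega : p.natDegree < m),
          (Polynomial.degree_lt_iff_coeff_zero _ _).1 hq m hm]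
        simp
    have h1 := hsV (mem_polySpace.2 ⟨_, hr, rfl⟩)
    have h2 := V.add_mem h1 (V.smul_mem c hpV)
    convert h2 using 1
    funext z
    simp

/-- A space of polynomials that is closed under division by zeros consists of all polynomials up to
some degree. -/
theorem exists_eq_polySpace {V : Submodule ℂ (ℂ → ℂ)}
    (hV : ∀ (g : ℂ → ℂ) (w : ℂ), Differentiable ℂ g → (fun z => (z - w) * g z) ∈ V → g ∈ V) (N : ℕ)
    (h : V ≤ polySpace N) : ∃ k ≤ N, V = polySpace k := by
  induction N with
  | zero => exact ⟨0, le_rfl, le_antisymm h fun f hf => by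
      obtain ⟨p, hp, rfl⟩ := mem_polySpace.1 hf
      have : p = 0 := by simpa using hp
      subst this
      simp only [Polynomial.eval_zero]
      exact V.zero_mem⟩
  | succ N ih =>
    by_cases hle : V ≤ polySpace N
    · obtain ⟨k, hk, hk'⟩ := ih hle
      exact ⟨k, by omega, hk'⟩
    · obtain ⟨f, hf, hfN⟩ := SetLike.not_le_iff_exists.1 hle
      obtain ⟨p, hp, rfl⟩ := mem_polySpace.1 (h hf)
      have hpN : ¬ p.degree < N := fun hlt => hfN (mem_polySpace.2 ⟨p, hlt, rfl⟩)
      have hp0 : p ≠ 0 := by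
        rintro rfl
        exact hpN (by simp)
      have hdeg : p.natDegree = N := by
        have h1 := (Polynomial.natDegree_lt_iff_degree_lt hp0).2 hp
        have h2 := mt (Polynomial.natDegree_lt_iff_degree_lt hp0).1 hpN
        omega
      exact ⟨N + 1, le_rfl, le_antisymm h (polySpace_succ_le hV N p hp0 hdeg hf)⟩

/-! ### Two-sided growth of polynomials in the closed upper half-plane. -/

/-- The weight `|z + i|` dominates both 1 and `|z|` in the closed upper half-plane, so every
monomial is bounded by the top power. -/
theorem exists_norm_eval_le {n : ℕ} {p : Polynomial ℂ} (hp : p.natDegree ≤ n) :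
    ∃ C : ℝ, 0 ≤ C ∧ ∀ z : ℂ, 0 ≤ z.im → ‖p.eval z‖ ≤ C * ‖z + Complex.I‖ ^ n := by
  refine ⟨∑ i ∈ Finset.range (n + 1), ‖p.coeff i‖, Finset.sum_nonneg fun _ _ => norm_nonneg _,
    fun z hz => ?_⟩
  rw [Polynomial.eval_eq_sum_range' (Nat.lt_succ_of_le hp), Finset.sum_mul]
  refine (norm_sum_le _ _).trans (Finset.sum_le_sum fun i hi => ?_)
  have h1 := one_le_norm_add_I hz
  have h2 : ‖z‖ ≤ ‖z + Complex.I‖ := by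
    rw [Complex.norm_def, Complex.norm_def]
    refine Real.sqrt_le_sqrt ?_
    simp only [Complex.normSq_apply, Complex.add_re, Complex.I_re, Complex.add_im, Complex.I_im]
    nlinarith
  rw [norm_mul, norm_pow]
  gcongr
  calc ‖z‖ ^ i ≤ ‖z + Complex.I‖ ^ i := by gcongr
    _ ≤ _ := pow_le_pow_right₀ h1 (Nat.lt_succ_iff.1 (Finset.mem_range.1 hi))

/-- The roots are split off one at a time. A root `a` lies strictly below the real axis, so `|z - a|
≥ -Im a`, and the constant `|a + i|` in `|z + i| ≤ |z - a| + |a + i|` is absorbed into a multiple of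
`|z - a|`. -/
theorem exists_pow_le_norm_eval (n : ℕ) : ∀ q : Polynomial ℂ, q.natDegree = n →
    (∀ z : ℂ, 0 ≤ z.im → q.eval z ≠ 0) →
    ∃ C : ℝ, 0 ≤ C ∧ ∀ z : ℂ, 0 ≤ z.im → ‖z + Complex.I‖ ^ n ≤ C * ‖q.eval z‖ := by
  induction n with
  | zero =>
    intro q hq h0
    obtain ⟨c, rfl⟩ := Polynomial.natDegree_eq_zero.1 hq
    have hc : c ≠ 0 := by simpa using h0 0
    exact ⟨‖c‖⁻¹, by positivity, fun z _ => by simp [hc]⟩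
  | succ n ih =>
    intro q hq h0
    have hq0 : q ≠ 0 := by rintro rfl; simp at hq
    obtain ⟨a, ha⟩ := IsAlgClosed.exists_root q (by
      rw [Polynomial.degree_eq_natDegree hq0, hq]
      exact_mod_cast Nat.succ_ne_zero n)
    have hai : a.im < 0 := not_le.1 fun h => h0 a h ha
    obtain ⟨s, rfl⟩ := Polynomial.dvd_iff_isRoot.2 ha
    have hs0 : s ≠ 0 := right_ne_zero_of_mul hq0
    have hsn : s.natDegree = n := by
      rw [Polynomial.natDegree_mul (Polynomial.X_sub_C_ne_zero a) hs0,
        Polynomial.natDegree_X_sub_C] at hq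
      omega
    obtain ⟨C, hC0, hC⟩ := ih s hsn fun z hz hsz => h0 z hz (by simp [hsz])
    refine ⟨C * (1 + ‖a + Complex.I‖ / -a.im), mul_nonneg hC0
      (add_nonneg zero_le_one (div_nonneg (norm_nonneg _) (by linarith))), fun z hz => ?_⟩
    have h1 : -a.im ≤ ‖z - a‖ := by
      refine le_trans ?_ (Complex.abs_im_le_norm (z - a))
      rw [Complex.sub_im]
      exact le_trans (by linarith) (le_abs_self _)
    have h2 : ‖z + Complex.I‖ ≤ (1 + ‖a + Complex.I‖ / -a.im) * ‖z - a‖ := by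
      calc ‖z + Complex.I‖ ≤ ‖z - a‖ + ‖a + Complex.I‖ := by
            refine le_trans (le_of_eq ?_) (norm_add_le (z - a) (a + Complex.I))
            congr 1
            ring
        _ = ‖z - a‖ + ‖a + Complex.I‖ / -a.im * -a.im := by
            rw [div_mul_cancel₀ _ (by linarith : -a.im ≠ 0)]
        _ ≤ ‖z - a‖ + ‖a + Complex.I‖ / -a.im * ‖z - a‖ := by
            have : 0 ≤ ‖a + Complex.I‖ / -a.im := div_nonneg (norm_nonneg _) (by linarith)
            gcongr
        _ = _ := by ring
    have h3 := mul_le_mul (hC z hz) h2 (norm_nonneg _) (mul_nonneg hC0 (norm_nonneg _))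
    rw [← pow_succ] at h3
    refine h3.trans_eq ?_
    simp only [Polynomial.eval_mul, Polynomial.eval_sub, Polynomial.eval_X, Polynomial.eval_C,
      norm_mul]
    ring

/-- The quotient of two polynomials decays in the closed upper half-plane as the degrees predict. -/
theorem exists_norm_div_mul_pow_le {p q : Polynomial ℂ} {k : ℕ}
    (hq : ∀ z : ℂ, 0 ≤ z.im → q.eval z ≠ 0) (hk : p.natDegree + k ≤ q.natDegree) :
    ∃ C : ℝ, ∀ z : ℂ, 0 ≤ z.im → ‖p.eval z / q.eval z‖ * ‖z + Complex.I‖ ^ k ≤ C := by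
  obtain ⟨m, hm⟩ := Nat.exists_eq_add_of_le' (le_of_add_le_right hk)
  obtain ⟨C₁, hC₁, h₁⟩ := exists_norm_eval_le (n := m) (p := p) (by omega)
  obtain ⟨C₂, hC₂, h₂⟩ := exists_pow_le_norm_eval _ q rfl hq
  refine ⟨C₁ * C₂, fun z hz => ?_⟩
  have hpos : 0 < ‖q.eval z‖ := norm_pos_iff.2 (hq z hz)
  rw [norm_div, div_mul_eq_mul_div, div_le_iff₀ hpos]
  calc ‖p.eval z‖ * ‖z + Complex.I‖ ^ k ≤ C₁ * ‖z + Complex.I‖ ^ m * ‖z + Complex.I‖ ^ k := by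
        gcongr
        exact h₁ z hz
    _ = C₁ * ‖z + Complex.I‖ ^ q.natDegree := by rw [hm]; ring
    _ ≤ C₁ * (C₂ * ‖q.eval z‖) := by
        gcongr
        exact h₂ z hz
    _ = _ := by ring

theorem sharp_eval (p : Polynomial ℂ) (z : ℂ) :
    sharp (fun z => p.eval z) z = (p.map (starRingEnd ℂ)).eval z := by
  have := Polynomial.hom_eval₂ p (RingHom.id ℂ) (starRingEnd ℂ) ((starRingEnd ℂ) z)
  simp only [Complex.conj_conj, RingHom.comp_id] at this
  rw [Polynomial.eval_map, ← this]
  rfl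

theorem polySpace_le_deBrangesSpace {q : Polynomial ℂ} (hq : ∀ z : ℂ, 0 ≤ z.im → q.eval z ≠ 0) :
    polySpace q.natDegree ≤ deBrangesSpace fun z => q.eval z := by
  intro f hf
  obtain ⟨p, hp, rfl⟩ := mem_polySpace.1 hf
  have key : ∀ p : Polynomial ℂ, p.degree < q.natDegree → IsHardy fun z => p.eval z / q.eval z := by
    intro p hp
    rcases eq_or_ne p 0 with rfl | hp0
    · simpa using isHardy_zero
    have hlt := (Polynomial.natDegree_lt_iff_degree_lt hp0).2 hp
    obtain ⟨C, hC⟩ := exists_norm_div_mul_pow_le (k := 1) hq (Nat.succ_le_of_lt hlt)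
    exact isHardy_of_bound (p.differentiable.differentiableOn.div q.differentiable.differentiableOn
      fun z hz => hq z (le_of_lt hz)) C fun z hz => by simpa using hC z hz.le
  refine mem_deBrangesSpace.2 ⟨p.differentiable, key p hp, ?_⟩
  simp_rw [sharp_eval]
  exact key _ (Polynomial.degree_map_le.trans_lt hp)

/-! ### Taylor coefficients against mean squares: the spaces of zero-free polynomials. -/

/-- By uniqueness of power series, estimates on circles of all radii concern the same coefficients.
-/
theorem cauchyPowerSeries_eq {f : ℂ → ℂ} (hf : Differentiable ℂ f) {r : ℝ} (hr : 0 < r) :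
    cauchyPowerSeries f 0 r = cauchyPowerSeries f 0 1 := by
  have h1 := hf.hasFPowerSeriesOnBall 0 (R := ⟨r, hr.le⟩) hr
  have h2 := hf.hasFPowerSeriesOnBall 0 (R := 1) one_pos
  exact h1.hasFPowerSeriesAt.eq_formalMultilinearSeries h2.hasFPowerSeriesAt

/-- Parseval-type bound for the Taylor coefficients of an entire function. -/
theorem norm_coeff_sq_le {f : ℂ → ℂ} (hf : Differentiable ℂ f) (k : ℕ) {r : ℝ} (hr : 0 < r) :
    ENNReal.ofReal (2 * Real.pi * (‖cauchyPowerSeries f 0 1 k‖ * r ^ k) ^ 2) ≤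
      ∫⁻ θ in Ioo (-Real.pi) Real.pi, ‖f (circleMap 0 r θ)‖ₑ ^ 2 := by
  have hpi := Real.pi_pos
  set M : ℝ := ‖cauchyPowerSeries f 0 1 k‖ * r ^ k with hM
  have hM0 : 0 ≤ M := by positivity
  set g : ℝ → ℝ := fun θ => ‖f (circleMap 0 r θ)‖ with hg
  have hgc : Continuous g := (hf.continuous.comp (continuous_circleMap 0 r)).norm
  have hper : Function.Periodic g (2 * Real.pi) := fun θ => by
    simp only [hg, periodic_circleMap 0 r θ]
  have h1 : 2 * Real.pi * M ≤ ∫ θ in (-Real.pi)..Real.pi, g θ := by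
    have h := norm_cauchyPowerSeries_le f 0 r k
    rw [cauchyPowerSeries_eq hf hr, abs_of_pos hr, inv_pow, ← div_eq_mul_inv,
      le_div_iff₀ (by positivity), inv_mul_eq_div, le_div_iff₀ (by positivity)] at h
    have h2 := hper.intervalIntegral_add_eq 0 (-Real.pi)
    rw [zero_add, show -Real.pi + 2 * Real.pi = Real.pi by ring] at h2
    rw [← h2, mul_comm]
    exact h
  have h2 : 2 * Real.pi * M ^ 2 ≤ ∫ θ in (-Real.pi)..Real.pi, g θ ^ 2 := by
    -- Expanding this square, together with `h1`, takes the place of the Cauchy--Schwarz inequality.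
    have h0 : 0 ≤ ∫ θ in (-Real.pi)..Real.pi, (g θ - M) ^ 2 :=
      intervalIntegral.integral_nonneg (by linarith) fun _ _ => sq_nonneg _
    have h3 : ∫ θ in (-Real.pi)..Real.pi, (g θ - M) ^ 2 =
        (∫ θ in (-Real.pi)..Real.pi, g θ ^ 2) - 2 * M * (∫ θ in (-Real.pi)..Real.pi, g θ) +
          2 * Real.pi * M ^ 2 := by
      have e : ∀ θ, (g θ - M) ^ 2 = g θ ^ 2 - 2 * M * g θ + M ^ 2 := fun θ => by ring
      simp_rw [e]
      rw [intervalIntegral.integral_add, intervalIntegral.integral_sub,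
        intervalIntegral.integral_const_mul, intervalIntegral.integral_const, smul_eq_mul]
      · ring
      all_goals exact Continuous.intervalIntegrable (by fun_prop) _ _
    nlinarith
  calc ENNReal.ofReal (2 * Real.pi * M ^ 2)
      ≤ ENNReal.ofReal (∫ θ in (-Real.pi)..Real.pi, g θ ^ 2) := ENNReal.ofReal_le_ofReal h2
    _ = ∫⁻ θ in Ioc (-Real.pi) Real.pi, ENNReal.ofReal (g θ ^ 2) := by
        rw [intervalIntegral.integral_of_le (by linarith)]
        exact ofReal_integral_eq_lintegral_ofReal
          ((hgc.pow 2).integrableOn_Ioc) (ae_of_all _ fun _ => sq_nonneg _)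
    _ = ∫⁻ θ in Ioo (-Real.pi) Real.pi, ‖f (circleMap 0 r θ)‖ₑ ^ 2 := by
        rw [restrict_Ioo_eq_restrict_Ioc]
        refine lintegral_congr fun θ => ?_
        rw [ENNReal.ofReal_pow (norm_nonneg _), ofReal_norm]

/-- The circle bound is integrated over `R < r < 2R` in polar coordinates. The Jacobian and the
width of the annulus supply the extra factor `R²`, and the annulus lies in the box. -/
theorem norm_coeff_sq_mul_le {f : ℂ → ℂ} (hf : Differentiable ℂ f) (k : ℕ) {R : ℝ} (hR : 0 < R) :
    ENNReal.ofReal (2 * Real.pi * ‖cauchyPowerSeries f 0 1 k‖ ^ 2 * R ^ (2 * k + 2)) ≤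
      ∫⁻ p in Ioo (-(2 * R)) (2 * R) ×ˢ Ioo (-(2 * R)) (2 * R),
        ‖f ((p.1 : ℂ) + (p.2 : ℂ) * Complex.I)‖ₑ ^ 2 := by
  set S : Set (ℝ × ℝ) := Ioo (-(2 * R)) (2 * R) ×ˢ Ioo (-(2 * R)) (2 * R) with hS
  have hSm : MeasurableSet S := measurableSet_Ioo.prod measurableSet_Ioo
  set c := ‖cauchyPowerSeries f 0 1 k‖ with hc
  set F : ℝ × ℝ → ENNReal := fun p => ‖f ((p.1 : ℂ) + (p.2 : ℂ) * Complex.I)‖ₑ ^ 2 with hF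
  have hFc : Continuous fun p : ℝ × ℝ => f ((p.1 : ℂ) + (p.2 : ℂ) * Complex.I) :=
    hf.continuous.comp (by fun_prop)
  have hFm : Measurable F := hFc.measurable.enorm.pow_const 2
  rw [← lintegral_indicator hSm, ← lintegral_comp_polarCoord_symm, polarCoord_target]
  calc ENNReal.ofReal (2 * Real.pi * c ^ 2 * R ^ (2 * k + 2))
      = ∫⁻ r in Ioo R (2 * R), ENNReal.ofReal (2 * Real.pi * c ^ 2 * R ^ (2 * k + 1)) := by
        rw [setLIntegral_const, Real.volume_Ioo, ← ENNReal.ofReal_mul (by positivity)]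
        congr 1
        ring
    _ ≤ ∫⁻ r in Ioo R (2 * R), ∫⁻ θ in Ioo (-Real.pi) Real.pi,
          ENNReal.ofReal r * F (polarCoord.symm (r, θ)) := by
        refine setLIntegral_mono' measurableSet_Ioo fun r hr => ?_
        have hr0 : 0 < r := hR.trans hr.1
        rw [lintegral_const_mul' _ _ ENNReal.ofReal_ne_top]
        have h1 := norm_coeff_sq_le hf k hr0
        calc ENNReal.ofReal (2 * Real.pi * c ^ 2 * R ^ (2 * k + 1))
            ≤ ENNReal.ofReal (r * (2 * Real.pi * (c * r ^ k) ^ 2)) := by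
              refine ENNReal.ofReal_le_ofReal ?_
              have : R ^ (2 * k + 1) ≤ r ^ (2 * k + 1) := pow_le_pow_left₀ hR.le hr.1.le _
              calc 2 * Real.pi * c ^ 2 * R ^ (2 * k + 1)
                  ≤ 2 * Real.pi * c ^ 2 * r ^ (2 * k + 1) := by gcongr
                _ = _ := by ring
          _ = ENNReal.ofReal r * ENNReal.ofReal (2 * Real.pi * (c * r ^ k) ^ 2) :=
              ENNReal.ofReal_mul hr0.le
          _ ≤ _ := by
              gcongr
              refine h1.trans_eq (lintegral_congr fun θ => ?_)
              simp only [hF, polarCoord_symm_apply, circleMap, Complex.exp_mul_I, zero_add]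
              congr 3
              push_cast
              ring
    _ = ∫⁻ p in Ioo R (2 * R) ×ˢ Ioo (-Real.pi) Real.pi,
          ENNReal.ofReal p.1 * F (polarCoord.symm p) := by
        rw [Measure.volume_eq_prod, setLIntegral_prod]
        have hpc : Measurable fun p : ℝ × ℝ => polarCoord.symm p := by
          simp only [polarCoord_symm_apply]
          fun_prop
        exact (measurable_fst.ennreal_ofReal.mul (hFm.comp hpc)).aemeasurable
    _ = ∫⁻ p in Ioo R (2 * R) ×ˢ Ioo (-Real.pi) Real.pi,
          ENNReal.ofReal p.1 • S.indicator F (polarCoord.symm p) := by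
        refine setLIntegral_congr_fun (measurableSet_Ioo.prod measurableSet_Ioo) fun p hp => ?_
        have hr0 : 0 < p.1 := hR.trans hp.1.1
        have hb : ∀ x : ℝ, |x| ≤ 1 → p.1 * x ∈ Ioo (-(2 * R)) (2 * R) := fun x hx => by
          rw [mem_Ioo, ← abs_lt, abs_mul, abs_of_pos hr0]
          nlinarith [hp.1.2]
        have hmem : polarCoord.symm p ∈ S := by
          rw [polarCoord_symm_apply]
          exact ⟨hb _ (Real.abs_cos_le_one _), hb _ (Real.abs_sin_le_one _)⟩
        simp only [indicator_of_mem hmem, smul_eq_mul]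
    _ ≤ _ := lintegral_mono_set (prod_mono (fun r hr => hR.trans hr.1) subset_rfl)

/-- An entire function whose square means over boxes grow like `R ^ (2 n + 1)` is a polynomial of
degree less than `n`. -/
theorem mem_polySpace_of_lintegral_le {f : ℂ → ℂ} (hf : Differentiable ℂ f) (n : ℕ) (C : ℝ)
    (h : ∀ R : ℝ, 1 ≤ R → ∫⁻ p in Ioo (-(2 * R)) (2 * R) ×ˢ Ioo (-(2 * R)) (2 * R),
        ‖f ((p.1 : ℂ) + (p.2 : ℂ) * Complex.I)‖ₑ ^ 2 ≤ ENNReal.ofReal (C * R ^ (2 * n + 1))) :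
    f ∈ polySpace n := by
  have hpi := Real.pi_pos
  set P := cauchyPowerSeries f 0 1 with hP
  have hzero : ∀ k, n ≤ k → P k = 0 := by
    intro k hk
    by_contra hne
    have hc : 0 < ‖P k‖ := norm_pos_iff.2 hne
    set D := 2 * Real.pi * ‖P k‖ ^ 2 with hD
    have hD0 : 0 < D := by positivity
    -- A nonzero coefficient of index `k ≥ n` would force `R * D ≤ |C|`, which this radius excludes.
    set R : ℝ := max 1 ((|C| + 1) / D) with hR
    have hR1 : 1 ≤ R := le_max_left _ _
    have hRC : |C| + 1 ≤ R * D := (div_le_iff₀ hD0).1 (le_max_right _ _)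
    have h1 := (norm_coeff_sq_mul_le hf k (zero_lt_one.trans_le hR1)).trans (h R hR1)
    have h2 : C * R ^ (2 * n + 1) ≤ |C| * R ^ (2 * k + 1) := by
      calc C * R ^ (2 * n + 1) ≤ |C| * R ^ (2 * n + 1) := by
            gcongr
            exact le_abs_self C
        _ ≤ _ := by gcongr
    have h3 := h1.trans (ENNReal.ofReal_le_ofReal h2)
    rw [ENNReal.ofReal_le_ofReal_iff (by positivity)] at h3
    have hRp : 0 < R ^ (2 * k + 1) := by positivity
    have h4 : D * R ^ (2 * k + 2) = R * D * R ^ (2 * k + 1) := by ring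
    rw [← hP, ← hD, h4] at h3
    have := le_of_mul_le_mul_right h3 hRp
    linarith
  have hps := hf.hasFPowerSeriesOnBall 0 (R := 1) one_pos
  refine mem_polySpace.2 ⟨∑ k ∈ Finset.range n, Polynomial.monomial k (P.coeff k), ?_, ?_⟩
  · refine (Polynomial.degree_sum_le _ _).trans_lt ?_
    rw [Finset.sup_lt_iff (by exact WithBot.bot_lt_coe n)]
    intro k hk
    exact (Polynomial.degree_monomial_le _ _).trans_lt
      (by exact_mod_cast Finset.mem_range.1 hk)
  · funext z
    have hs := hps.hasSum (y := z) (by simp)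
    rw [zero_add] at hs
    have hs' := hasSum_sum_of_ne_finset_zero (L := SummationFilter.unconditional ℕ) (f := fun k => P k fun _ => z)
      (s := Finset.range n) (fun k hk => by
        rw [hzero k (by simpa using hk)]
        rfl)
    rw [hs.unique hs', Polynomial.eval_finsetSum]
    refine Finset.sum_congr rfl fun k _ => ?_
    rw [FormalMultilinearSeries.apply_eq_pow_smul_coeff, Polynomial.eval_monomial, smul_eq_mul,
      mul_comm]

/-- Multiplying back by `|q| ≤ C (5R)^n` turns the Hardy bounds into mean square bounds of order
`R^(2n)` on segments, hence `R^(2n+1)` on boxes. This is one power short of what a Taylor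
coefficient of index `n` would require. -/
theorem deBrangesSpace_le_polySpace {q : Polynomial ℂ} (hq : ∀ z : ℂ, 0 ≤ z.im → q.eval z ≠ 0) :
    deBrangesSpace (fun z => q.eval z) ≤ polySpace q.natDegree := by
  intro f hf
  obtain ⟨hfd, h1, h2⟩ := mem_deBrangesSpace.1 hf
  obtain ⟨C, hC0, hC⟩ := exists_norm_eval_le (le_refl q.natDegree)
  set n := q.natDegree with hn
  have line : ∀ g : ℂ → ℂ, IsHardy (fun z => g z / q.eval z) → ∃ M : ℝ, 0 ≤ M ∧ ∀ R : ℝ, 1 ≤ R →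
      ∀ v : ℝ, 0 < v → v < 2 * R → ∫⁻ u in Ioo (-(2 * R)) (2 * R),
        ‖g ((u : ℂ) + (v : ℂ) * Complex.I)‖ₑ ^ 2 ≤ ENNReal.ofReal (M * R ^ (2 * n)) := by
    intro g hg
    set m := (⨆ (v : ℝ) (_ : 0 < v), ∫⁻ u : ℝ,
      ‖g ((u : ℂ) + (v : ℂ) * Complex.I) / q.eval ((u : ℂ) + (v : ℂ) * Complex.I)‖ₑ ^ 2) with hm
    have hmtop : m < ⊤ := hg.2
    refine ⟨(C * 5 ^ n) ^ 2 * m.toReal, by positivity, fun R hR v hv hvR => ?_⟩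
    have hpt : ∀ u ∈ Ioo (-(2 * R)) (2 * R), ‖g ((u : ℂ) + (v : ℂ) * Complex.I)‖ₑ ^ 2 ≤
        ENNReal.ofReal ((C * (5 * R) ^ n) ^ 2) * ‖g ((u : ℂ) + (v : ℂ) * Complex.I) /
          q.eval ((u : ℂ) + (v : ℂ) * Complex.I)‖ₑ ^ 2 := fun u hu => by
      set z : ℂ := (u : ℂ) + (v : ℂ) * Complex.I with hz
      have him : 0 < z.im := by simpa [hz] using hv
      have hzn : ‖z + Complex.I‖ ≤ 5 * R := by
        have hu' : |u| ≤ 2 * R := (abs_lt.2 hu).le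
        calc ‖z + Complex.I‖ ≤ ‖(u : ℂ)‖ + ‖(v : ℂ) * Complex.I‖ + ‖Complex.I‖ := norm_add₃_le
          _ = |u| + |v| + 1 := by simp
          _ ≤ 5 * R := by rw [abs_of_pos hv]; linarith
      have hqz : ‖q.eval z‖ ≤ C * (5 * R) ^ n := (hC z him.le).trans (by gcongr)
      rw [← ofReal_norm, ← ofReal_norm, ← ENNReal.ofReal_pow (norm_nonneg _),
        ← ENNReal.ofReal_pow (norm_nonneg _), ← ENNReal.ofReal_mul (by positivity), ← mul_pow]
      refine ENNReal.ofReal_le_ofReal (pow_le_pow_left₀ (norm_nonneg _) ?_ 2)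
      have hpos : 0 < ‖q.eval z‖ := norm_pos_iff.2 (hq z him.le)
      calc ‖g z‖ = ‖q.eval z‖ * ‖g z / q.eval z‖ := by rw [norm_div]; field_simp
        _ ≤ _ := by gcongr
    calc _ ≤ ∫⁻ u in Ioo (-(2 * R)) (2 * R), ENNReal.ofReal ((C * (5 * R) ^ n) ^ 2) *
          ‖g ((u : ℂ) + (v : ℂ) * Complex.I) /
            q.eval ((u : ℂ) + (v : ℂ) * Complex.I)‖ₑ ^ 2 :=
          setLIntegral_mono' measurableSet_Ioo hpt
      _ ≤ ∫⁻ u : ℝ, ENNReal.ofReal ((C * (5 * R) ^ n) ^ 2) *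
          ‖g ((u : ℂ) + (v : ℂ) * Complex.I) /
            q.eval ((u : ℂ) + (v : ℂ) * Complex.I)‖ₑ ^ 2 := setLIntegral_le_lintegral _ _
      _ ≤ ENNReal.ofReal ((C * (5 * R) ^ n) ^ 2) * m := by
          rw [lintegral_const_mul' _ _ ENNReal.ofReal_ne_top]
          gcongr
          exact le_iSup₂_of_le (f := fun (v : ℝ) (_ : 0 < v) => ∫⁻ u : ℝ,
            ‖g ((u : ℂ) + (v : ℂ) * Complex.I) /
              q.eval ((u : ℂ) + (v : ℂ) * Complex.I)‖ₑ ^ 2) v hv le_rfl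
      _ = _ := by
          rw [← ENNReal.ofReal_toReal hmtop.ne, ← ENNReal.ofReal_mul (by positivity),
            ENNReal.toReal_ofReal ENNReal.toReal_nonneg]
          congr 1
          rw [mul_pow 5 R]
          ring
  obtain ⟨M₁, hM₁, hl₁⟩ := line f h1
  obtain ⟨M₂, hM₂, hl₂⟩ := line (sharp f) h2
  refine mem_polySpace_of_lintegral_le hfd n (4 * max M₁ M₂) fun R hR => ?_
  have hFc : Continuous fun p : ℝ × ℝ => f ((p.1 : ℂ) + (p.2 : ℂ) * Complex.I) :=
    hfd.continuous.comp (by fun_prop)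
  rw [Measure.volume_eq_prod, setLIntegral_prod_symm _
    (hFc.measurable.enorm.pow_const 2).aemeasurable]
  have hline : ∀ᵐ v : ℝ ∂(volume.restrict (Ioo (-(2 * R)) (2 * R))),
      ∫⁻ u in Ioo (-(2 * R)) (2 * R), ‖f ((u : ℂ) + (v : ℂ) * Complex.I)‖ₑ ^ 2 ≤
        ENNReal.ofReal (max M₁ M₂ * R ^ (2 * n)) := by
    rw [ae_restrict_iff' measurableSet_Ioo]
    have h0 : ∀ᵐ v : ℝ, v ≠ 0 := by simp [ae_iff]
    filter_upwards [h0] with v hv0 hv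
    rcases hv0.lt_or_gt with hneg | hpos
    -- Below the real axis `|f(u + iv)| = |f^♯(u - iv)|`, so the bound for `f^♯ / q` applies at
    -- height `-v`.
    · refine le_trans (le_of_eq (lintegral_congr fun u => ?_))
        ((hl₂ R hR (-v) (by linarith) (by linarith [hv.1])).trans (ENNReal.ofReal_le_ofReal (by
          gcongr
          exact le_max_right _ _)))
      congr 1
      rw [← ofReal_norm, ← ofReal_norm]
      simp [sharp]
    · exact (hl₁ R hR v hpos hv.2).trans (ENNReal.ofReal_le_ofReal (by
        gcongr
        exact le_max_left _ _))
  refine (lintegral_mono_ae hline).trans (le_of_eq ?_)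
  rw [setLIntegral_const, Real.volume_Ioo, ← ENNReal.ofReal_mul (by positivity)]
  congr 1
  ring

theorem deBrangesSpace_eval {q : Polynomial ℂ} (hq : ∀ z : ℂ, 0 ≤ z.im → q.eval z ≠ 0) :
    deBrangesSpace (fun z => q.eval z) = polySpace q.natDegree :=
  le_antisymm (deBrangesSpace_le_polySpace hq) (polySpace_le_deBrangesSpace hq)

/-! ### Equality of norms by contour integration. -/

theorem integrable_of_bound {g : ℝ → ℂ} (hg : Continuous g) (C : ℝ)
    (h : ∀ x : ℝ, ‖g x‖ * ‖(x : ℂ) + Complex.I‖ ^ 2 ≤ C) : Integrable g := by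
  refine (integrable_inv_one_add_sq.const_mul C).mono' hg.aestronglyMeasurable
    (ae_of_all _ fun x => ?_)
  have h1 := one_add_sq_le_normSq (z := (x : ℂ)) (by simp)
  rw [Complex.ofReal_re] at h1
  rw [← div_eq_mul_inv, le_div_iff₀ (by positivity)]
  exact (mul_le_mul_of_nonneg_left h1 (norm_nonneg _)).trans (h x)

/-- Cauchy's theorem for the upper half-plane. -/
theorem integral_eq_zero_of_bound {g : ℂ → ℂ} (hg : DifferentiableOn ℂ g {z : ℂ | 0 ≤ z.im}) (C : ℝ)
    (h : ∀ z : ℂ, 0 ≤ z.im → ‖g z‖ * ‖z + Complex.I‖ ^ 2 ≤ C) : ∫ x : ℝ, g x = 0 := by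
  have hC : 0 ≤ C := le_trans (by positivity) (h 0 (by simp))
  have hgc : Continuous fun x : ℝ => g x :=
    hg.continuousOn.comp_continuous Complex.continuous_ofReal fun x => by simp
  have hint := integrable_of_bound hgc C fun x => h x (by simp)
  have hlim := intervalIntegral_tendsto_integral hint tendsto_neg_atTop_atBot tendsto_id
  refine tendsto_nhds_unique hlim ?_
  have hbound : ∀ R : ℝ, 0 < R → ∀ z : ℂ, 0 ≤ z.im → (R ≤ |z.re| ∨ R ≤ z.im) →
      ‖g z‖ ≤ C / R ^ 2 := by
    intro R hR z hz hzR
    rw [le_div_iff₀ (by positivity)]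
    refine le_trans ?_ (h z hz)
    gcongr
    rcases hzR with h1 | h1
    · exact h1.trans (by simpa using Complex.abs_re_le_norm (z + Complex.I))
    · refine le_trans ?_ ((le_abs_self _).trans (Complex.abs_im_le_norm (z + Complex.I)))
      simp only [Complex.add_im, Complex.I_im]
      linarith
  -- The rectangle is `[-R, R] × [0, R]`. Its three sides off the real axis have total length `4R`,
  -- and the integrand there is at most `C / R²`.
  have hle : ∀ᶠ R : ℝ in atTop, ‖∫ x in (-R)..id R, g x‖ ≤ 4 * C / R := by
    filter_upwards [eventually_gt_atTop 0] with R hR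
    have hrect := Complex.integral_boundary_rect_eq_zero_of_differentiableOn g
      ((-R : ℝ) : ℂ) ((R : ℝ) + (R : ℝ) * Complex.I) (hg.mono fun z hz => by
        have h2 := hz.2
        simp only [Complex.ofReal_im, Complex.add_im, Complex.mul_im, Complex.I_im, Complex.I_re,
          Complex.ofReal_re, mul_one, mul_zero, add_zero, zero_add, uIcc_of_le hR.le,
          mem_preimage] at h2
        exact h2.1)
    simp only [Complex.ofReal_re, Complex.ofReal_im, Complex.add_re, Complex.add_im, Complex.mul_re,
      Complex.mul_im, Complex.I_re, Complex.I_im, mul_one, mul_zero, sub_zero, add_zero, zero_add,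
      Complex.ofReal_zero, zero_mul, smul_eq_mul] at hrect
    have h1 : ‖∫ x in (-R)..R, g ((x : ℂ) + (R : ℂ) * Complex.I)‖ ≤ C / R ^ 2 * |R - -R| :=
      intervalIntegral.norm_integral_le_of_norm_le_const fun x _ =>
        hbound R hR _ (by simpa using hR.le) (by simp)
    have h2 : ‖∫ y in (0 : ℝ)..R, g ((R : ℂ) + (y : ℂ) * Complex.I)‖ ≤ C / R ^ 2 * |R - 0| :=
      intervalIntegral.norm_integral_le_of_norm_le_const fun y hy => by
        rw [uIoc_of_le hR.le] at hy
        exact hbound R hR _ (by simpa using hy.1.le) (by simp [le_abs_self])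
    have h3 : ‖∫ y in (0 : ℝ)..R, g (((-R : ℝ) : ℂ) + (y : ℂ) * Complex.I)‖ ≤ C / R ^ 2 * |R - 0| :=
      intervalIntegral.norm_integral_le_of_norm_le_const fun y hy => by
        rw [uIoc_of_le hR.le] at hy
        exact hbound R hR _ (by simpa using hy.1.le) (by simp [le_abs_self])
    have heq : ∫ x in (-R)..id R, g x = (∫ x in (-R)..R, g ((x : ℂ) + (R : ℂ) * Complex.I)) -
        Complex.I * (∫ y in (0 : ℝ)..R, g ((R : ℂ) + (y : ℂ) * Complex.I)) +
        Complex.I * ∫ y in (0 : ℝ)..R, g (((-R : ℝ) : ℂ) + (y : ℂ) * Complex.I) := by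
      simp only [id]
      linear_combination hrect
    rw [heq]
    refine (norm_add_le _ _).trans ((add_le_add_left (norm_sub_le _ _) _).trans ?_)
    rw [norm_mul, norm_mul, Complex.norm_I, one_mul, one_mul]
    rw [sub_neg_eq_add, abs_of_pos (by linarith)] at h1
    rw [sub_zero, abs_of_pos hR] at h2 h3
    calc _ ≤ C / R ^ 2 * (R + R) + C / R ^ 2 * R + C / R ^ 2 * R := by gcongr
      _ = 4 * C / R := by field_simp; ring
  exact squeeze_zero_norm' hle (tendsto_const_nhds.div_atTop tendsto_id)

theorem deBrangesNorm_eq_of_integral_eq {E F f : ℂ → ℂ}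
    (hE : Integrable fun x : ℝ => ‖f x / E x‖ ^ 2) (hF : Integrable fun x : ℝ => ‖f x / F x‖ ^ 2)
    (h : ∫ x : ℝ, ‖f x / E x‖ ^ 2 = ∫ x : ℝ, ‖f x / F x‖ ^ 2) :
    deBrangesNorm E f = deBrangesNorm F f := by
  have key : ∀ G : ℂ → ℂ, (Integrable fun x : ℝ => ‖f x / G x‖ ^ 2) →
      ∫⁻ x : ℝ, ‖f x / G x‖ₑ ^ (2 : ENNReal).toReal =
        ENNReal.ofReal (∫ x : ℝ, ‖f x / G x‖ ^ 2) := by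
    intro G hG
    rw [ofReal_integral_eq_lintegral_ofReal hG (ae_of_all _ fun _ => by positivity)]
    refine lintegral_congr fun x => ?_
    rw [ENNReal.ofReal_pow (norm_nonneg _), ofReal_norm, ENNReal.toReal_ofNat,
      ENNReal.rpow_ofNat]
  unfold deBrangesNorm
  rw [eLpNorm_eq_lintegral_rpow_enorm_toReal (by simp) (by simp),
    eLpNorm_eq_lintegral_rpow_enorm_toReal (by simp) (by simp), key E hE, key F hF, h]

/-- If `1 / |a|² - 1 / |b|²` is the real part of `r / (a b)` on the real line, then `a` and `b` give
the same norm to every polynomial of small degree. -/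
theorem deBrangesNorm_eval_eq {a b p r : Polynomial ℂ} (ha : ∀ z : ℂ, 0 ≤ z.im → a.eval z ≠ 0)
    (hb : ∀ z : ℂ, 0 ≤ z.im → b.eval z ≠ 0) (hpa : p.natDegree + 1 ≤ a.natDegree)
    (hpb : p.natDegree + 1 ≤ b.natDegree)
    (hr : 2 * p.natDegree + r.natDegree + 2 ≤ a.natDegree + b.natDegree)
    (h : ∀ x : ℝ, ‖b.eval (x : ℂ)‖ ^ 2 - ‖a.eval (x : ℂ)‖ ^ 2 =
      (r.eval (x : ℂ) * (starRingEnd ℂ) (a.eval (x : ℂ) * b.eval (x : ℂ))).re) :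
    deBrangesNorm (fun z => a.eval z) (fun z => p.eval z) =
      deBrangesNorm (fun z => b.eval z) (fun z => p.eval z) := by
  have hint : ∀ q : Polynomial ℂ, (∀ z : ℂ, 0 ≤ z.im → q.eval z ≠ 0) →
      p.natDegree + 1 ≤ q.natDegree → Integrable fun x : ℝ => ‖p.eval (x : ℂ) / q.eval (x : ℂ)‖ ^ 2 := by
    intro q hq hd
    obtain ⟨C, hC⟩ := exists_norm_div_mul_pow_le (k := 1) hq hd
    have hc : Continuous fun x : ℝ => (p.eval (x : ℂ) / q.eval (x : ℂ)) ^ 2 :=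
      ((p.continuous.comp Complex.continuous_ofReal).div
        (q.continuous.comp Complex.continuous_ofReal) fun x => hq x (by simp)).pow 2
    have := (integrable_of_bound hc (C ^ 2) fun x => by
      rw [norm_pow, ← mul_pow]
      exact pow_le_pow_left₀ (by positivity) (by simpa using hC x (by simp)) 2).norm
    simpa [norm_pow] using this
  refine deBrangesNorm_eq_of_integral_eq (hint a ha hpa) (hint b hb hpb) ?_
  rw [← sub_eq_zero, ← integral_sub (hint a ha hpa) (hint b hb hpb)]
  -- On the real line `p p^♯ = |p|²`, so `s / (a b)` is a holomorphic function whose real part is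
  -- the difference of the two integrands. The degree condition `hr` gives it quadratic decay.
  set s := p * p.map (starRingEnd ℂ) * r with hs
  have hab : ∀ z : ℂ, 0 ≤ z.im → (a * b).eval z ≠ 0 := fun z hz => by
    rw [Polynomial.eval_mul]
    exact mul_ne_zero (ha z hz) (hb z hz)
  have hdeg : s.natDegree + 2 ≤ (a * b).natDegree := by
    have ha0 : a ≠ 0 := by rintro rfl; simp at hpa
    have hb0 : b ≠ 0 := by rintro rfl; simp at hpb
    rw [Polynomial.natDegree_mul ha0 hb0]
    have h1 : s.natDegree ≤ _ := Polynomial.natDegree_mul_le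
    have h2 : (p * p.map (starRingEnd ℂ)).natDegree ≤ _ := Polynomial.natDegree_mul_le
    have h3 : (p.map (starRingEnd ℂ)).natDegree ≤ _ := Polynomial.natDegree_map_le
    omega
  obtain ⟨C, hC⟩ := exists_norm_div_mul_pow_le hab hdeg
  have hd : DifferentiableOn ℂ (fun z => s.eval z / (a * b).eval z) {z : ℂ | 0 ≤ z.im} :=
    s.differentiable.differentiableOn.div (a * b).differentiable.differentiableOn hab
  have hzero := integral_eq_zero_of_bound hd C hC
  have hgint : Integrable fun x : ℝ => s.eval (x : ℂ) / (a * b).eval (x : ℂ) :=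
    integrable_of_bound (hd.continuousOn.comp_continuous Complex.continuous_ofReal fun x => by simp)
      C fun x => hC x (by simp)
  have hre := integral_re hgint
  simp only [RCLike.re_eq_complex_re] at hre
  rw [hzero, Complex.zero_re] at hre
  rw [← hre]
  refine integral_congr_ae (ae_of_all _ fun x => ?_)
  have hax := ha x (by simp)
  have hbx := hb x (by simp)
  have hna : ‖a.eval (x : ℂ)‖ ^ 2 ≠ 0 := by simpa using hax
  have hnb : ‖b.eval (x : ℂ)‖ ^ 2 ≠ 0 := by simpa using hbx
  have hsx : s.eval (x : ℂ) = ((‖p.eval (x : ℂ)‖ ^ 2 : ℝ) : ℂ) * r.eval (x : ℂ) := by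
    rw [hs, Polynomial.eval_mul, Polynomial.eval_mul, ← sharp_eval]
    simp only [sharp, Complex.conj_ofReal, Complex.mul_conj, Complex.normSq_eq_norm_sq]
  have hquot : s.eval (x : ℂ) / (a * b).eval (x : ℂ) =
      ((‖p.eval (x : ℂ)‖ ^ 2 / (‖a.eval (x : ℂ)‖ ^ 2 * ‖b.eval (x : ℂ)‖ ^ 2) : ℝ) : ℂ) *
        (r.eval (x : ℂ) * (starRingEnd ℂ) (a.eval (x : ℂ) * b.eval (x : ℂ))) := by
    rw [hsx, Polynomial.eval_mul]
    push_cast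
    rw [← Complex.mul_conj' (a.eval (x : ℂ)), ← Complex.mul_conj' (b.eval (x : ℂ)), map_mul]
    have h1 : (starRingEnd ℂ) (a.eval (x : ℂ)) ≠ 0 := by simpa using hax
    have h2 : (starRingEnd ℂ) (b.eval (x : ℂ)) ≠ 0 := by simpa using hbx
    field_simp
  simp only
  rw [hquot, Complex.re_ofReal_mul, ← h x, norm_div, norm_div]
  field_simp

/-! ### The Hamiltonian `H₀`: indivisible intervals and regular points. -/

theorem H₀_of_mem {t : ℝ} (h : 1 / 2 ≤ t ∧ t < 9 / 2) : H₀ t = !![1, 0; 0, 0] := if_pos h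

theorem H₀_of_notMem {t : ℝ} (h : ¬ (1 / 2 ≤ t ∧ t < 9 / 2)) : H₀ t = !![0, 0; 0, 1] := if_neg h

theorem trace_H₀ (t : ℝ) : (H₀ t).trace = 1 := by
  by_cases h : 1 / 2 ≤ t ∧ t < 9 / 2
  · simp [H₀_of_mem h, Matrix.trace_fin_two]
  · simp [H₀_of_notMem h, Matrix.trace_fin_two]

theorem H₀_off_diag (t : ℝ) : H₀ t 0 1 = 0 ∧ H₀ t 1 0 = 0 := by
  by_cases h : 1 / 2 ≤ t ∧ t < 9 / 2
  · simp [H₀_of_mem h]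
  · simp [H₀_of_notMem h]

theorem measurable_H₀ (i j : Fin 2) : Measurable fun t => H₀ t i j := by
  have hs : MeasurableSet {t : ℝ | 1 / 2 ≤ t ∧ t < 9 / 2} := measurableSet_Ico
  have : (fun t => H₀ t i j) = fun t =>
      if 1 / 2 ≤ t ∧ t < 9 / 2 then (!![1, 0; 0, 0] : Matrix (Fin 2) (Fin 2) ℝ) i j
      else (!![0, 0; 0, 1] : Matrix (Fin 2) (Fin 2) ℝ) i j := by
    funext t
    unfold H₀
    split_ifs <;> rfl
  rw [this]
  exact Measurable.ite hs measurable_const measurable_const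

theorem abs_H₀_le (i j : Fin 2) (t : ℝ) : ‖H₀ t i j‖ ≤ 1 := by
  unfold H₀
  split_ifs <;> fin_cases i <;> fin_cases j <;> simp

theorem intervalIntegrable_H₀ (i j : Fin 2) (a b : ℝ) :
    IntervalIntegrable (fun t => H₀ t i j) volume a b :=
  (intervalIntegrable_const (c := (1 : ℝ))).mono_fun'
    (measurable_H₀ i j).aestronglyMeasurable (ae_of_all _ (abs_H₀_le i j))

theorem isHamiltonian_H₀ (I : Set ℝ) : IsHamiltonian H₀ I where
  isSymm t _ := by
    unfold H₀
    split_ifs <;> ext i j <;> fin_cases i <;> fin_cases j <;> rfl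
  nonneg := ae_of_all _ fun t => by
    have h : ∃ d : Fin 2 → ℝ, 0 ≤ d ∧ H₀ t = Matrix.diagonal d := by
      unfold H₀
      split_ifs
      · refine ⟨![1, 0], fun i => by fin_cases i <;> simp, ?_⟩
        ext i j
        fin_cases i <;> fin_cases j <;> rfl
      · refine ⟨![0, 1], fun i => by fin_cases i <;> simp, ?_⟩
        ext i j
        fin_cases i <;> fin_cases j <;> rfl
    obtain ⟨d, hd, h⟩ := h
    rw [h]
    exact Matrix.PosSemidef.diagonal hd
  ne_zero S _ hpos := by
    obtain ⟨t, ht⟩ := nonempty_of_measure_ne_zero hpos.ne'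
    refine ⟨t, ht, fun h0 => ?_⟩
    have := trace_H₀ t
    simp [h0] at this
  locInt i j := by
    have : LocallyIntegrable (fun t => H₀ t i j) volume :=
      (locallyIntegrable_const (1 : ℝ)).mono (measurable_H₀ i j).aestronglyMeasurable
        (ae_of_all _ fun t => by simpa using abs_H₀_le i j t)
    exact this.locallyIntegrableOn I

theorem limitCircleLeft_H₀ : LimitCircleLeft H₀ 0 5 := by
  refine ⟨1, by norm_num, ?_⟩
  simp_rw [trace_H₀]
  exact integrableOn_const (by simp)

theorem limitCircleRight_H₀ : LimitCircleRight H₀ 0 5 := by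
  refine ⟨1, by norm_num, ?_⟩
  simp_rw [trace_H₀]
  exact integrableOn_const (by simp)

theorem isIndivisible_H₀_pi_div_two {I : Set ℝ} {a b : ℝ} (hab : a < b) (hI : Ioo a b ⊆ I)
    (h : ∀ t ∈ Ioo a b, ¬ (1 / 2 ≤ t ∧ t < 9 / 2)) : IsIndivisible H₀ I a b (Real.pi / 2) := by
  refine ⟨hab, hI, (ae_restrict_iff' measurableSet_Ioo).2 (ae_of_all _ fun t ht => ?_)⟩
  rw [H₀_of_notMem (h t ht)]
  ext i
  fin_cases i <;> simp [matJ, Matrix.vecMul, dotProduct, Matrix.mul_apply, Fin.sum_univ_two]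

theorem isIndivisible_H₀_zero {I : Set ℝ} {a b : ℝ} (hab : a < b) (hI : Ioo a b ⊆ I)
    (h : ∀ t ∈ Ioo a b, 1 / 2 ≤ t ∧ t < 9 / 2) : IsIndivisible H₀ I a b 0 := by
  refine ⟨hab, hI, (ae_restrict_iff' measurableSet_Ioo).2 (ae_of_all _ fun t ht => ?_)⟩
  rw [H₀_of_mem (h t ht)]
  ext i
  fin_cases i <;> simp [matJ, Matrix.vecMul, dotProduct, Matrix.mul_apply, Fin.sum_univ_two]

theorem exists_mem_Ioo_of_ae {P : ℝ → Prop} {a b c d : ℝ} (h : ∀ᵐ t ∂(volume.restrict (Ioo a b)), P t)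
    (hcd : c < d) (hs : Ioo c d ⊆ Ioo a b) : ∃ t ∈ Ioo c d, P t := by
  have h' : ∀ᵐ t ∂(volume.restrict (Ioo c d)), t ∈ Ioo c d ∧ P t :=
    (ae_restrict_mem measurableSet_Ioo).and (ae_restrict_of_ae_restrict_of_subset hs h)
  have : (volume.restrict (Ioo c d)) ≠ 0 := by
    rw [Ne, Measure.restrict_eq_zero, Real.volume_Ioo]
    simpa using hcd
  have : NeZero (volume.restrict (Ioo c d)) := ⟨this⟩
  exact h'.exists

/-- An indivisible interval does not meet both kinds of pieces of `H₀`. -/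
theorem not_isIndivisible_H₀ {I : Set ℝ} {a b θ c d c' d' : ℝ} (h : IsIndivisible H₀ I a b θ)
    (hcd : c < d) (hs : Ioo c d ⊆ Ioo a b) (hcd' : c' < d') (hs' : Ioo c' d' ⊆ Ioo a b)
    (h1 : ∀ t ∈ Ioo c d, 1 / 2 ≤ t ∧ t < 9 / 2)
    (h2 : ∀ t ∈ Ioo c' d', ¬ (1 / 2 ≤ t ∧ t < 9 / 2)) : False := by
  obtain ⟨s, hs1, hs2⟩ := exists_mem_Ioo_of_ae h.2.2 hcd hs
  obtain ⟨t, ht1, ht2⟩ := exists_mem_Ioo_of_ae h.2.2 hcd' hs'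
  rw [H₀_of_mem (h1 s hs1)] at hs2
  rw [H₀_of_notMem (h2 t ht1)] at ht2
  -- The row `[cos θ, sin θ] J` equals `[sin θ, -cos θ]`, so one kind of piece forces `sin θ = 0`
  -- and the other `cos θ = 0`.
  have e1 := congrFun hs2 0
  have e2 := congrFun ht2 1
  simp only [matJ, Matrix.vecMul, dotProduct, Matrix.mul_apply, Fin.sum_univ_two] at e1 e2
  simp at e1 e2
  have := Real.sin_sq_add_cos_sq θ
  simp [e1, e2] at this

/-- The interval is left open between `(0, 5)` and `[0, 5]` because both `(0, 5]` and `[0, 5]` are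
needed. -/
theorem regularPoints_H₀ {I : Set ℝ} (h1 : Ioo 0 5 ⊆ I) (h2 : I ⊆ Icc 0 5) :
    regularPoints H₀ I = I ∩ {0, 1 / 2, 9 / 2, 5} := by
  ext t
  simp only [regularPoints, mem_ofPred_eq, mem_inter_iff, mem_insert_iff, mem_singleton_iff]
  refine and_congr_right fun htI => ⟨fun h => ?_, fun h => ?_⟩
  · by_contra hne
    push Not at hne
    obtain ⟨n0, n1, n2, n3⟩ := hne
    obtain ⟨l0, l5⟩ := h2 htI
    have p0 := lt_of_le_of_ne l0 n0.symm
    have p5 := lt_of_le_of_ne l5 n3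
    rcases n1.lt_or_gt with hlt | hgt
    · exact h ⟨0, 1 / 2, _, isIndivisible_H₀_pi_div_two (by norm_num)
        (fun x hx => h1 ⟨hx.1, by linarith [hx.2]⟩) (fun x hx hx' => by linarith [hx.2, hx'.1]),
        p0, hlt⟩
    · rcases n2.lt_or_gt with hlt' | hgt'
      · exact h ⟨1 / 2, 9 / 2, _, isIndivisible_H₀_zero (by norm_num)
          (fun x hx => h1 ⟨by linarith [hx.1], by linarith [hx.2]⟩)
          (fun x hx => ⟨hx.1.le, hx.2⟩), hgt, hlt'⟩
      · exact h ⟨9 / 2, 5, _, isIndivisible_H₀_pi_div_two (by norm_num)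
          (fun x hx => h1 ⟨by linarith [hx.1], hx.2⟩) (fun x hx hx' => by linarith [hx.1, hx'.2]),
          hgt', p5⟩
  · rintro ⟨a, b, θ, hab, ha, hb⟩
    rcases h with rfl | rfl | rfl | rfl
    -- An indivisible interval around the endpoint 0 would contain the negative point `a / 2`, which
    -- is not in `I`. The last case treats 5 in the same way.
    · have := (h2 (hab.2.1 ⟨by linarith, by linarith⟩ : a / 2 ∈ I)).1
      linarith
    · refine not_isIndivisible_H₀ hab (c := 1 / 2) (d := min b (9 / 2)) (c' := a) (d' := 1 / 2)
        (lt_min hb (by norm_num)) (Ioo_subset_Ioo ha.le (min_le_left _ _)) ha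
        (Ioo_subset_Ioo le_rfl hb.le) (fun x hx => ⟨hx.1.le, hx.2.trans_le (min_le_right _ _)⟩)
        fun x hx hx' => by linarith [hx.2, hx'.1]
    · refine not_isIndivisible_H₀ hab (c := max a (1 / 2)) (d := 9 / 2) (c' := 9 / 2) (d' := b)
        (max_lt ha (by norm_num)) (Ioo_subset_Ioo (le_max_left _ _) hb.le) hb
        (Ioo_subset_Ioo ha.le le_rfl) (fun x hx => ⟨(le_max_right _ _).trans hx.1.le, hx.2⟩)
        fun x hx hx' => by linarith [hx.1, hx'.2]
    · have := (h2 (hab.2.1 ⟨by linarith, by linarith⟩ : (5 + b) / 2 ∈ I)).2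
      linarith

/-! ### The matrix `W₀` solves the initial value problem. -/

/-- `W₀` as the product of the transfer matrices of the three pieces of `H₀`. -/
theorem W₀_eq (t : ℝ) (z : ℂ) : W₀ t z =
    !![1, 0; -((min t (1 / 2) : ℝ) * z), 1] * !![1, ((max 0 (min (t - 1 / 2) 4) : ℝ) * z); 0, 1] *
      !![1, 0; -((max 0 (t - 9 / 2) : ℝ) * z), 1] := by
  unfold W₀
  split_ifs with h1 h2
  · rw [min_eq_left h1.le, max_eq_left (min_le_of_left_le (by linarith)),
      max_eq_left (by linarith)]
    ext i j
    fin_cases i <;> fin_cases j <;> simp [Matrix.mul_apply, Fin.sum_univ_two]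
  · push Not at h1
    rw [min_eq_right h1, min_eq_left (by linarith), max_eq_right (by linarith),
      max_eq_left (by linarith)]
    ext i j
    fin_cases i <;> fin_cases j <;> simp [Matrix.mul_apply, Fin.sum_univ_two]
    ring
  · push Not at h1 h2
    rw [min_eq_right h1, min_eq_right (by linarith), max_eq_right (by linarith),
      max_eq_right (by linarith)]
    ext i j
    fin_cases i <;> fin_cases j <;> simp [Matrix.mul_apply, Fin.sum_univ_two] <;> ring

/-- The truncated lengths in `W₀_eq` are continuous in `t`, which settles the switching points
without cases. -/
theorem continuous_W₀ (z : ℂ) : Continuous fun t => W₀ t z := by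
  simp_rw [W₀_eq]
  refine (Continuous.matrix_mul ?_ ?_).matrix_mul ?_ <;>
    · refine continuous_matrix fun i j => ?_
      fin_cases i <;> fin_cases j <;> simp <;> fun_prop

theorem continuous_W₀_apply (z : ℂ) (i j : Fin 2) : Continuous fun t => W₀ t z i j :=
  (continuous_W₀ z).matrix_elem i j

/-- Since `H₀` is diagonal, the matrix equation decouples into these two scalar ones for each row,
and all entries are affine in `t` on each piece. -/
theorem hasDerivAt_W₀ (z : ℂ) {t : ℝ} (h1 : t ≠ 1 / 2) (h2 : t ≠ 9 / 2) (i : Fin 2) :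
    HasDerivAt (fun t => W₀ t z i 0) (-(z * W₀ t z i 1 * (H₀ t 1 1 : ℝ))) t ∧
      HasDerivAt (fun t => W₀ t z i 1) (z * W₀ t z i 0 * (H₀ t 0 0 : ℝ)) t := by
  have hid : HasDerivAt (fun t : ℝ => (t : ℂ)) 1 t := Complex.ofRealCLM.hasDerivAt
  have haff : ∀ (f : ℝ → ℂ) (a b : ℂ), (∀ s : ℝ, f s = a + s * b) → HasDerivAt f b t := by
    intro f a b h
    rw [funext h]
    simpa using (hid.mul_const b).const_add a
  rcases h1.lt_or_gt with hlt | hgt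
  · have hev : ∀ᶠ s in 𝓝 t, W₀ s z = !![1, 0; -(s * z), 1] := by
      filter_upwards [Iio_mem_nhds hlt] with s hs
      exact if_pos hs
    have hH := H₀_of_notMem (t := t) fun h => by linarith [h.1]
    rw [hH, hev.self_of_nhds]
    have hc : ∀ j, (fun s => W₀ s z i j) =ᶠ[𝓝 t]
        fun s : ℝ => (!![1, 0; -(s * z), 1] : Matrix (Fin 2) (Fin 2) ℂ) i j := fun j =>
      hev.mono fun s hs => by simp only [hs]
    refine ⟨HasDerivAt.congr_of_eventuallyEq ?_ (hc 0), HasDerivAt.congr_of_eventuallyEq ?_ (hc 1)⟩ <;>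
      fin_cases i <;> simp
    · exact hasDerivAt_const _ _
    · exact haff _ 0 _ fun s => by ring
    · exact hasDerivAt_const _ _
    · exact hasDerivAt_const _ _
  · rcases h2.lt_or_gt with hlt | hgt'
    · have hev : ∀ᶠ s in 𝓝 t, W₀ s z =
          !![1, (s - 1 / 2) * z; -(1 / 2) * z, 1 + 1 / 4 * (1 - 2 * s) * z ^ 2] := by
        filter_upwards [Ioo_mem_nhds hgt hlt] with s hs
        exact (if_neg (not_lt.2 hs.1.le)).trans (if_pos hs.2)
      have hH := H₀_of_mem (t := t) ⟨hgt.le, hlt⟩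
      rw [hH, hev.self_of_nhds]
      have hc : ∀ j, (fun s => W₀ s z i j) =ᶠ[𝓝 t]
          fun s : ℝ => (!![1, (s - 1 / 2) * z; -(1 / 2) * z, 1 + 1 / 4 * (1 - 2 * s) * z ^ 2] :
            Matrix (Fin 2) (Fin 2) ℂ) i j := fun j => hev.mono fun s hs => by simp only [hs]
      refine ⟨HasDerivAt.congr_of_eventuallyEq ?_ (hc 0),
        HasDerivAt.congr_of_eventuallyEq ?_ (hc 1)⟩ <;> fin_cases i <;> simp
      · exact hasDerivAt_const _ _
      · exact hasDerivAt_const _ _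
      · exact haff _ (-(2⁻¹ * z)) _ fun s => by ring
      · exact haff _ (4⁻¹ * z ^ 2) _ fun s => by ring
    · have hev : ∀ᶠ s in 𝓝 t, W₀ s z =
          !![1 + (18 - 4 * s) * z ^ 2, 4 * z; (2 * s - 9) * z ^ 3 - (s - 4) * z, 1 - 2 * z ^ 2] := by
        filter_upwards [Ioi_mem_nhds hgt'] with s hs
        have hs' : 9 / 2 < s := hs
        exact (if_neg (by linarith)).trans (if_neg (by linarith))
      have hH := H₀_of_notMem (t := t) fun h => by linarith [h.2]
      rw [hH, hev.self_of_nhds]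
      have hc : ∀ j, (fun s => W₀ s z i j) =ᶠ[𝓝 t]
          fun s : ℝ => (!![1 + (18 - 4 * s) * z ^ 2, 4 * z; (2 * s - 9) * z ^ 3 - (s - 4) * z,
            1 - 2 * z ^ 2] : Matrix (Fin 2) (Fin 2) ℂ) i j := fun j =>
        hev.mono fun s hs => by simp only [hs]
      refine ⟨HasDerivAt.congr_of_eventuallyEq ?_ (hc 0),
        HasDerivAt.congr_of_eventuallyEq ?_ (hc 1)⟩ <;> fin_cases i <;> simp
      · exact haff _ (18 * z ^ 2) _ fun s => by ring
      · exact haff _ (-9 * z ^ 3 + 4 * z) _ fun s => by ring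
      · exact hasDerivAt_const _ _
      · exact hasDerivAt_const _ _

theorem W₀_zero (z : ℂ) : W₀ 0 z = 1 := by
  rw [W₀, if_pos (by norm_num)]
  ext i j
  fin_cases i <;> fin_cases j <;> simp

theorem intervalIntegrable_H₀_smul {E : Type*} [NormedAddCommGroup E] [NormedSpace ℝ E] {f : ℝ → E}
    (hf : Continuous f) (i j : Fin 2) (a b : ℝ) :
    IntervalIntegrable (fun t => H₀ t i j • f t) volume a b :=
  (intervalIntegrable_H₀ i j a b).smul_continuousOn hf.continuousOn

theorem integral_W₀ (z : ℂ) (s t : ℝ) (i : Fin 2) :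
    (∫ u in s..t, -(z * W₀ u z i 1 * (H₀ u 1 1 : ℝ)) = W₀ t z i 0 - W₀ s z i 0) ∧
      ∫ u in s..t, z * W₀ u z i 0 * (H₀ u 0 0 : ℝ) = W₀ t z i 1 - W₀ s z i 1 := by
  have hc : ({1 / 2, 9 / 2} : Set ℝ).Countable := (Set.toFinite _).countable
  constructor
  · refine integral_eq_of_hasDerivAt_off_countable (fun t => W₀ t z i 0) _ hc
      (continuous_W₀_apply z i 0).continuousOn (fun x hx => ?_) ?_
    · have hx2 := hx.2
      simp only [mem_insert_iff, mem_singleton_iff, not_or] at hx2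
      exact (hasDerivAt_W₀ z hx2.1 hx2.2 i).1
    · have := intervalIntegrable_H₀_smul
        ((continuous_W₀_apply z i 1).const_mul (-z)) 1 1 s t
      refine this.congr fun u _ => ?_
      simp only [Complex.real_smul]
      ring
  · refine integral_eq_of_hasDerivAt_off_countable (fun t => W₀ t z i 1) _ hc
      (continuous_W₀_apply z i 1).continuousOn (fun x hx => ?_) ?_
    · have hx2 := hx.2
      simp only [mem_insert_iff, mem_singleton_iff, not_or] at hx2
      exact (hasDerivAt_W₀ z hx2.1 hx2.2 i).2
    · have := intervalIntegrable_H₀_smul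
        ((continuous_W₀_apply z i 0).const_mul z) 0 0 s t
      refine this.congr fun u _ => ?_
      simp only [Complex.real_smul]
      ring

/-- Open intervals are used because the value of `H₀` at an endpoint of a piece may belong to the
neighbouring piece. -/
theorem intervalIntegral_congr_Ioo {f g : ℝ → ℂ} {a b : ℝ} (hab : a ≤ b)
    (h : ∀ u ∈ Ioo a b, f u = g u) : ∫ u in a..b, f u = ∫ u in a..b, g u := by
  rw [intervalIntegral.integral_of_le hab, intervalIntegral.integral_of_le hab,
    ← restrict_Ioo_eq_restrict_Ioc]
  exact setIntegral_congr_fun measurableSet_Ioo h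

theorem isFundamentalSolution_W₀ (I : Set ℝ) : IsFundamentalSolution H₀ I 0 W₀ := by
  refine fun z => ⟨W₀_zero z, (continuous_W₀ z).continuousOn, fun s _ t _ i j => ?_⟩
  obtain ⟨h0, h1⟩ := integral_W₀ z s t i
  fin_cases j
  · simp only [Matrix.mul_apply, Fin.sum_univ_two, toC, Matrix.map_apply, matJ]
    simp only [Fin.zero_eta, Matrix.of_apply, Matrix.cons_val_zero, Matrix.cons_val_one,
      (H₀_off_diag _).2]
    simp only [mul_zero, mul_one, zero_add, Complex.ofReal_zero, add_zero]
    rw [← h1]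
    exact intervalIntegral.integral_congr fun u _ => by ring
  · simp only [Matrix.mul_apply, Fin.sum_univ_two, toC, Matrix.map_apply, matJ]
    simp only [Fin.mk_one, Matrix.of_apply, Matrix.cons_val_zero, Matrix.cons_val_one,
      (H₀_off_diag _).1]
    simp only [mul_zero, mul_neg, mul_one, zero_add, Complex.ofReal_zero, add_zero]
    rw [show -W₀ t z i 0 - -W₀ s z i 0 = -(W₀ t z i 0 - W₀ s z i 0) by ring, ← h0,
      ← intervalIntegral.integral_neg]
    exact intervalIntegral.integral_congr fun u _ => by ring

/-! ### Uniqueness of the fundamental solution. -/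

section Uniqueness

variable {W : ℝ → ℂ → Matrix (Fin 2) (Fin 2) ℂ}

theorem IsFundamentalSolution.sub_eq {I : Set ℝ} (hW : IsFundamentalSolution H₀ I 0 W) (z : ℂ)
    {s t : ℝ} (hs : s ∈ I) (ht : t ∈ I) (i : Fin 2) :
    (W t z i 1 - W s z i 1 = ∫ u in s..t, z * (W u z i 0 * (H₀ u 0 0 : ℝ))) ∧
      W s z i 0 - W t z i 0 = ∫ u in s..t, z * (W u z i 1 * (H₀ u 1 1 : ℝ)) := by
  have h := (hW z).2.2 s hs t ht i
  have h0 := h 0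
  have h1 := h 1
  simp only [Matrix.mul_apply, Fin.sum_univ_two, toC, Matrix.map_apply, matJ] at h0 h1
  simp only [Matrix.of_apply, Matrix.cons_val_zero, Matrix.cons_val_one, (H₀_off_diag _).1,
    (H₀_off_diag _).2] at h0 h1
  simp only [mul_zero, mul_neg, mul_one, zero_add, Complex.ofReal_zero, add_zero] at h0 h1
  exact ⟨h0, by rw [← h1]; ring⟩

/-- Here `H₀` annihilates the first column in the product, so the second column is constant. The
first is then the integral of a constant, and the solution is computed explicitly from its value at
`a`. -/
theorem IsFundamentalSolution.eq_of_notMem (hW : IsFundamentalSolution H₀ (Icc 0 5) 0 W) (z : ℂ)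
    {a b t : ℝ} (ha : 0 ≤ a) (hb : b ≤ 5) (h : ∀ u ∈ Ioo a b, ¬ (1 / 2 ≤ u ∧ u < 9 / 2))
    (ht : t ∈ Icc a b) (i : Fin 2) :
    W t z i 1 = W a z i 1 ∧ W t z i 0 = W a z i 0 - (t - a) * z * W a z i 1 := by
  have key : ∀ t ∈ Icc a b, W t z i 1 = W a z i 1 := fun t ht => by
    have := (hW.sub_eq z (s := a) ⟨ha, by linarith [ht.1, ht.2]⟩
      (t := t) ⟨by linarith [ht.1], by linarith [ht.2]⟩ i).1
    rw [intervalIntegral_congr_Ioo (g := fun _ => 0) ht.1 fun u hu => by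
      simp [H₀_of_notMem (h u ⟨hu.1, hu.2.trans_le ht.2⟩)]] at this
    simpa [sub_eq_zero] using this
  refine ⟨key t ht, ?_⟩
  have := (hW.sub_eq z (s := a) ⟨ha, by linarith [ht.1, ht.2]⟩
    (t := t) ⟨by linarith [ht.1], by linarith [ht.2]⟩ i).2
  rw [intervalIntegral_congr_Ioo (g := fun _ => z * W a z i 1) ht.1 fun u hu => by
    simp [H₀_of_notMem (h u ⟨hu.1, hu.2.trans_le ht.2⟩),
      key u ⟨hu.1.le, hu.2.le.trans ht.2⟩], intervalIntegral.integral_const,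
    Complex.real_smul] at this
  push_cast at this
  linear_combination -this

theorem IsFundamentalSolution.eq_of_mem (hW : IsFundamentalSolution H₀ (Icc 0 5) 0 W) (z : ℂ)
    {a b t : ℝ} (ha : 0 ≤ a) (hb : b ≤ 5) (h : ∀ u ∈ Ioo a b, 1 / 2 ≤ u ∧ u < 9 / 2)
    (ht : t ∈ Icc a b) (i : Fin 2) :
    W t z i 0 = W a z i 0 ∧ W t z i 1 = W a z i 1 + (t - a) * z * W a z i 0 := by
  have key : ∀ t ∈ Icc a b, W t z i 0 = W a z i 0 := fun t ht => by
    have := (hW.sub_eq z (s := a) ⟨ha, by linarith [ht.1, ht.2]⟩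
      (t := t) ⟨by linarith [ht.1], by linarith [ht.2]⟩ i).2
    rw [intervalIntegral_congr_Ioo (g := fun _ => 0) ht.1 fun u hu => by
      simp [H₀_of_mem (h u ⟨hu.1, hu.2.trans_le ht.2⟩)]] at this
    rw [intervalIntegral.integral_zero, sub_eq_zero] at this
    exact this.symm
  refine ⟨key t ht, ?_⟩
  have := (hW.sub_eq z (s := a) ⟨ha, by linarith [ht.1, ht.2]⟩
    (t := t) ⟨by linarith [ht.1], by linarith [ht.2]⟩ i).1
  rw [intervalIntegral_congr_Ioo (g := fun _ => z * W a z i 0) ht.1 fun u hu => by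
    simp [H₀_of_mem (h u ⟨hu.1, hu.2.trans_le ht.2⟩),
      key u ⟨hu.1.le, hu.2.le.trans ht.2⟩], intervalIntegral.integral_const,
    Complex.real_smul] at this
  push_cast at this
  linear_combination this

theorem IsFundamentalSolution.eq_of_eq {V : ℝ → ℂ → Matrix (Fin 2) (Fin 2) ℂ}
    (hV : IsFundamentalSolution H₀ (Icc 0 5) 0 V) (hW : IsFundamentalSolution H₀ (Icc 0 5) 0 W)
    (z : ℂ) {a b t : ℝ} (ha : 0 ≤ a) (hb : b ≤ 5)
    (h : (∀ u ∈ Ioo a b, 1 / 2 ≤ u ∧ u < 9 / 2) ∨ ∀ u ∈ Ioo a b, ¬ (1 / 2 ≤ u ∧ u < 9 / 2))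
    (ht : t ∈ Icc a b) (hVW : V a z = W a z) : V t z = W t z := by
  ext i j
  rcases h with h | h
  · obtain ⟨v0, v1⟩ := hV.eq_of_mem z ha hb h ht i
    obtain ⟨w0, w1⟩ := hW.eq_of_mem z ha hb h ht i
    fin_cases j
    · simp only [Fin.zero_eta, v0, w0, hVW]
    · simp only [Fin.mk_one, v1, w1, hVW]
  · obtain ⟨v0, v1⟩ := hV.eq_of_notMem z ha hb h ht i
    obtain ⟨w0, w1⟩ := hW.eq_of_notMem z ha hb h ht i
    fin_cases j
    · simp only [Fin.zero_eta, v1, w1, hVW]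
    · simp only [Fin.mk_one, v0, w0, hVW]

theorem IsFundamentalSolution.unique {V : ℝ → ℂ → Matrix (Fin 2) (Fin 2) ℂ}
    (hV : IsFundamentalSolution H₀ (Icc 0 5) 0 V) (hW : IsFundamentalSolution H₀ (Icc 0 5) 0 W)
    (z : ℂ) {t : ℝ} (ht : t ∈ Icc (0 : ℝ) 5) : V t z = W t z := by
  have h1 : ∀ t ∈ Icc (0 : ℝ) (1 / 2), V t z = W t z := fun t ht =>
    hV.eq_of_eq hW z le_rfl (by norm_num)
      (.inr fun u hu hu' => by linarith [hu.2, hu'.1]) ht ((hV z).1.trans (hW z).1.symm)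
  have h2 : ∀ t ∈ Icc (1 / 2 : ℝ) (9 / 2), V t z = W t z := fun t ht =>
    hV.eq_of_eq hW z (by norm_num) (by norm_num) (.inl fun u hu => ⟨hu.1.le, hu.2⟩) ht
      (h1 _ (by norm_num))
  rcases le_total t (1 / 2) with h | h
  · exact h1 t ⟨ht.1, h⟩
  · rcases le_total t (9 / 2) with h' | h'
    · exact h2 t ⟨h, h'⟩
    · exact hV.eq_of_eq hW z (by norm_num) le_rfl
        (.inr fun u hu hu' => by linarith [hu.1, hu'.2]) ⟨h', ht.2⟩ (h2 _ (by norm_num))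

end Uniqueness

/-! ### The canonical system and the Hermite--Biehler property. -/

/-- Transposing `w' J = z w H` for the lower row `w` of `W₀` gives `X' = z J H X`, because `H` is
symmetric and `J` antisymmetric. -/
theorem isCanonicalSolution_W₀ (I : Set ℝ) (z : ℂ) :
    IsCanonicalSolution H₀ I z fun t => ![W₀ t z 1 0, W₀ t z 1 1] := by
  refine ⟨(continuous_pi fun i => ?_).continuousOn, fun s _ t _ => ?_⟩
  · fin_cases i
    · exact continuous_W₀_apply z 1 0
    · exact continuous_W₀_apply z 1 1
  have hF : ∀ u, z • Matrix.mulVec (matJ ℂ * toC (H₀ u)) ![W₀ u z 1 0, W₀ u z 1 1] =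
      ![-(z * W₀ u z 1 1 * (H₀ u 1 1 : ℝ)), z * W₀ u z 1 0 * (H₀ u 0 0 : ℝ)] := fun u => by
    ext i
    simp only [Pi.smul_apply, Matrix.mulVec, dotProduct, Fin.sum_univ_two, Matrix.mul_apply, matJ,
      toC, Matrix.map_apply, (H₀_off_diag u).1, (H₀_off_diag u).2]
    fin_cases i <;> simp <;> ring
  have hint : IntervalIntegrable (fun u =>
      z • Matrix.mulVec (matJ ℂ * toC (H₀ u)) ![W₀ u z 1 0, W₀ u z 1 1]) volume s t := by
    have c0 : Continuous fun u => (![0, z * W₀ u z 1 0] : Fin 2 → ℂ) := continuous_pi fun i => by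
      fin_cases i
      · exact continuous_const
      · exact (continuous_W₀_apply z 1 0).const_mul z
    have c1 : Continuous fun u => (![-z * W₀ u z 1 1, 0] : Fin 2 → ℂ) := continuous_pi fun i => by
      fin_cases i
      · exact (continuous_W₀_apply z 1 1).const_mul (-z)
      · exact continuous_const
    refine ((intervalIntegrable_H₀_smul c0 0 0 s t).add
      (intervalIntegrable_H₀_smul c1 1 1 s t)).congr fun u _ => ?_
    simp only [hF]
    ext i
    fin_cases i <;> simp <;> ring
  obtain ⟨h0, h1⟩ := integral_W₀ z s t 1
  ext i
  rw [show (∫ u in s..t, z • Matrix.mulVec (matJ ℂ * toC (H₀ u)) ![W₀ u z 1 0, W₀ u z 1 1]) i =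
      ∫ u in s..t, (z • Matrix.mulVec (matJ ℂ * toC (H₀ u)) ![W₀ u z 1 0, W₀ u z 1 1]) i from
    ((ContinuousLinearMap.proj (R := ℝ) (φ := fun _ : Fin 2 => ℂ) i).intervalIntegral_comp_comm
      hint).symm]
  simp only [hF]
  fin_cases i
  · simpa using h0.symm
  · simpa using h1.symm

/-- The identity behind this is `|A - iB|² - |A + iB|² = 4 Im (conj A * B)`. On the real line `A`
and `B` are real, so `A - iB` vanishes only where both do. -/
theorem isHB_sub {A B : ℂ → ℂ} (hA : Differentiable ℂ A) (hB : Differentiable ℂ B)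
    (hAs : sharp A = A) (hBs : sharp B = B)
    (hpos : ∀ z : ℂ, 0 < z.im → 0 < ((starRingEnd ℂ) (A z) * B z).im)
    (h0 : ∀ x : ℝ, A x ≠ 0 ∨ B x ≠ 0) : IsHB fun z => A z - Complex.I * B z where
  entire := hA.sub (hB.const_mul _)
  norm_lt z hz := by
    have hs : sharp (fun z => A z - Complex.I * B z) z = A z + Complex.I * B z := by
      have h1 := congrFun hAs z
      have h2 := congrFun hBs z
      simp only [sharp] at h1 h2 ⊢
      rw [map_sub, map_mul, h1, h2, Complex.conj_I]
      ring
    rw [hs, ← sq_lt_sq₀ (norm_nonneg _) (norm_nonneg _), ← Complex.normSq_eq_norm_sq,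
      ← Complex.normSq_eq_norm_sq]
    have := hpos z hz
    simp only [Complex.mul_im, Complex.conj_re, Complex.conj_im] at this
    simp only [Complex.normSq_apply, Complex.add_re, Complex.add_im, Complex.sub_re, Complex.sub_im,
      Complex.mul_re, Complex.mul_im, Complex.I_re, Complex.I_im]
    nlinarith
  real_ne_zero x hx := by
    have real : ∀ F : ℂ → ℂ, sharp F = F → (F x).im = 0 := fun F hF => by
      have := congrFun hF x
      simp only [sharp, Complex.conj_ofReal] at this
      exact Complex.conj_eq_iff_im.1 this
    have hAi := real A hAs
    have hBi := real B hBs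
    have e1 := congrArg Complex.re hx
    have e2 := congrArg Complex.im hx
    simp only [Complex.sub_re, Complex.mul_re, Complex.I_re, Complex.I_im, hAi, hBi, Complex.sub_im,
      Complex.mul_im, Complex.zero_re, Complex.zero_im] at e1 e2
    rcases h0 x with h | h
    · exact h (Complex.ext (by simpa using e1) hAi)
    · exact h (Complex.ext (by simpa using e2) hBi)

theorem W₀_of_lt {t : ℝ} (h : t < 1 / 2) : ((fun z => W₀ t z 1 0) = fun z : ℂ => -((t : ℂ) * z)) ∧
    (fun z => W₀ t z 1 1) = fun _ : ℂ => (1 : ℂ) := by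
  constructor <;> funext z <;> rw [W₀, if_pos h] <;> rfl

theorem W₀_of_mem {t : ℝ} (h1 : 1 / 2 ≤ t) (h2 : t < 9 / 2) :
    ((fun z => W₀ t z 1 0) = fun z : ℂ => -(1 / 2) * z) ∧
    (fun z => W₀ t z 1 1) = fun z : ℂ => 1 + 1 / 4 * (1 - 2 * (t : ℂ)) * z ^ 2 := by
  constructor <;> funext z <;> rw [W₀, if_neg h1.not_gt, if_pos h2] <;> rfl

theorem W₀_of_le {t : ℝ} (h : 9 / 2 ≤ t) :
    ((fun z => W₀ t z 1 0) = fun z : ℂ => (2 * (t : ℂ) - 9) * z ^ 3 - ((t : ℂ) - 4) * z) ∧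
    (fun z => W₀ t z 1 1) = fun z : ℂ => 1 - 2 * z ^ 2 := by
  constructor <;> funext z <;> rw [W₀, if_neg (by linarith), if_neg h.not_gt] <;> rfl

theorem isHB_Et {t : ℝ} (ht : 0 < t) : IsHB (Et t) := by
  by_cases h1 : t < 1 / 2
  · obtain ⟨hA, hB⟩ := W₀_of_lt h1
    refine isHB_sub (A := fun z => W₀ t z 1 0) (B := fun z => W₀ t z 1 1) ?_ ?_ ?_ ?_ ?_ ?_
    · rw [hA]; fun_prop
    · rw [hB]; fun_prop
    · rw [hA]; funext z; simp [sharp]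
    · rw [hB]; funext z; simp [sharp]
    · intro z hz
      simp only [congrFun hA z, congrFun hB z]
      simpa [congrFun hA z, congrFun hB z] using mul_pos ht hz
    · intro x
      right
      simp [congrFun hB x]
  push Not at h1
  by_cases h2 : t < 9 / 2
  · obtain ⟨hA, hB⟩ := W₀_of_mem h1 h2
    refine isHB_sub (A := fun z => W₀ t z 1 0) (B := fun z => W₀ t z 1 1) ?_ ?_ ?_ ?_ ?_ ?_
    · rw [hA]; fun_prop
    · rw [hB]; fun_prop
    · rw [hA]; funext z; simp [sharp, map_ofNat]
    · rw [hB]; funext z; simp [sharp, map_ofNat]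
    · intro z hz
      simp only [congrFun hA z, congrFun hB z]
      -- The quantity `Im (conj C * D)` has `t`-derivative `Im z` times the Hamiltonian form at `(C,
      -- D)`. Each summand is thus the length of a piece traversed times `|D|²` or `|C|²`, whichever
      -- is constant there.
      have key : ((starRingEnd ℂ) (-(1 / 2) * z) * (1 + 1 / 4 * (1 - 2 * t) * z ^ 2)).im =
          z.im * (1 / 2 + (t - 1 / 2) * (z.re ^ 2 + z.im ^ 2) / 4) := by
        simp [pow_two]
        ring
      rw [key]
      have : 0 ≤ t - 1 / 2 := by linarith
      positivity
    · intro x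
      simp only [congrFun hA x, congrFun hB x]
      rcases eq_or_ne x 0 with rfl | hx
      · right; simp
      · left; simpa using hx
  push Not at h2
  obtain ⟨hA, hB⟩ := W₀_of_le h2
  refine isHB_sub (A := fun z => W₀ t z 1 0) (B := fun z => W₀ t z 1 1) ?_ ?_ ?_ ?_ ?_ ?_
  · rw [hA]; fun_prop
  · rw [hB]; fun_prop
  · rw [hA]; funext z; simp [sharp, map_ofNat]
  · rw [hB]; funext z; simp [sharp, map_ofNat]
  · intro z hz
    simp only [congrFun hA z, congrFun hB z]
    have key : ((starRingEnd ℂ) ((2 * t - 9) * z ^ 3 - (t - 4) * z) * (1 - 2 * z ^ 2)).im =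
        z.im * (1 / 2 + (z.re ^ 2 + z.im ^ 2) +
          (t - 9 / 2) * ((1 - 2 * (z.re ^ 2 - z.im ^ 2)) ^ 2 + (4 * z.re * z.im) ^ 2)) := by
      simp [pow_succ]
      ring
    rw [key]
    have : 0 ≤ t - 9 / 2 := by linarith
    positivity
  · intro x
    simp only [congrFun hA x, congrFun hB x]
    by_contra! hcon
    obtain ⟨e1, e2⟩ := hcon
    -- The combination eliminates the cubic term of `C` by means of `D = 1 - 2x²`; at the remaining
    -- point 0 one has `D = 1`.
    have hx : (x : ℂ) = 0 := by linear_combination -2 * e1 - (2 * t - 9) * (x : ℂ) * e2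
    simp [hx] at e2

theorem Et_five (z : ℂ) : Et 5 z = E₀ z := by
  simp only [Et, E₀, W₀]
  rw [if_neg (by norm_num), if_neg (by norm_num)]
  simp only [Matrix.of_apply, Matrix.cons_val_zero, Matrix.cons_val_one]
  push_cast
  ring

theorem Et_zero (z : ℂ) : Et 0 z = -Complex.I := by
  simp only [Et, W₀]
  rw [if_pos (by norm_num)]
  simp

theorem Et_half (z : ℂ) : Et (1 / 2) z = -z / 2 - Complex.I := by
  simp only [Et, W₀]
  rw [if_neg (by norm_num), if_pos (by norm_num)]
  simp only [Matrix.of_apply, Matrix.cons_val_zero, Matrix.cons_val_one]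
  push_cast
  ring

theorem Et_nine_halves (z : ℂ) : Et (9 / 2) z = -z / 2 + Complex.I * (2 * z ^ 2 - 1) := by
  simp only [Et, W₀]
  rw [if_neg (by norm_num), if_neg (by norm_num)]
  simp only [Matrix.of_apply, Matrix.cons_val_zero, Matrix.cons_val_one]
  push_cast
  ring

theorem W₀_five (z : ℂ) :
    W₀ 5 z = !![1 - 2 * z ^ 2, 4 * z; z ^ 3 - z, 1 - 2 * z ^ 2] := by
  rw [W₀, if_neg (by norm_num), if_neg (by norm_num)]
  ext i j
  fin_cases i <;> fin_cases j <;> simp <;> ring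

theorem partA_E₀ (z : ℂ) : W₀ 5 z 1 0 = partA E₀ z := by
  rw [W₀_five]
  simp [partA, E₀, sharp, map_ofNat]
  ring

theorem partB_E₀ (z : ℂ) : W₀ 5 z 1 1 = partB E₀ z := by
  rw [W₀_five]
  simp [partB, E₀, sharp, map_ofNat]
  linear_combination (1 - 2 * z ^ 2) * Complex.I_mul_I

/-- On the first piece `C = -tz` and `D = 1`, so the diagonal of the kernel is the constant `t / π`.
-/
theorem tendsto_kernelDiag_W₀ (z : ℂ) :
    Tendsto (fun t => kernelDiag (fun z => W₀ t z 1 0) (fun z => W₀ t z 1 1) z) (𝓝[>] 0) (𝓝 0) := by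
  have hlim : Tendsto (fun t : ℝ => (t : ℂ) / Real.pi) (𝓝[>] 0) (𝓝 0) := by
    have : Continuous fun t : ℝ => (t : ℂ) / Real.pi := by fun_prop
    simpa using (this.tendsto 0).mono_left nhdsWithin_le_nhds
  refine hlim.congr' ?_
  filter_upwards [Ioo_mem_nhdsGT (show (0 : ℝ) < 1 / 2 by norm_num)] with t ht
  obtain ⟨hA, hB⟩ := W₀_of_lt ht.2
  rw [hA, hB, kernelDiag]
  have hpi : (Real.pi : ℂ) ≠ 0 := by exact_mod_cast Real.pi_ne_zero
  split_ifs with h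
  · have hd : deriv (fun z : ℂ => -((t : ℂ) * z)) z = -t := by
      simp
    rw [hd]
    simp
  · have hz : z - (starRingEnd ℂ) z ≠ 0 := fun h0 => h (Complex.conj_eq_iff_im.1 (sub_eq_zero.1 h0).symm)
    simp only [map_neg, map_mul, Complex.conj_ofReal, map_one]
    field_simp
    ring

/-! ### The chain of the four spaces and the subspaces of `𝓗(E₀)`. -/

open Polynomial in
/-- The polynomials `E(t_k, z)`. -/
noncomputable def polyE : Fin 4 → ℂ[X] :=
  ![C (-Complex.I), C (-1 / 2) * X + C (-Complex.I),
    C (2 * Complex.I) * X ^ 2 + C (-1 / 2) * X + C (-Complex.I),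
    X ^ 3 + C (2 * Complex.I) * X ^ 2 + C (-1) * X + C (-Complex.I)]

theorem eval_polyE (k : Fin 4) : (fun z => (polyE k).eval z) = Et (tPt k) := by
  funext z
  fin_cases k
  · exact (by simp [polyE] : (polyE 0).eval z = _).trans (Et_zero z).symm
  · exact (by simp [polyE]; ring : (polyE 1).eval z = _).trans (Et_half z).symm
  · exact (by simp [polyE]; ring : (polyE 2).eval z = _).trans (Et_nine_halves z).symm
  · refine (?_ : (polyE 3).eval z = E₀ z).trans (Et_five z).symm
    simp [polyE, E₀]
    ring

theorem natDegree_polyE (k : Fin 4) : (polyE k).natDegree = k := by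
  fin_cases k
  · simp [polyE]
  · simp only [polyE]
    exact Polynomial.natDegree_linear (by norm_num)
  · simp only [polyE]
    exact Polynomial.natDegree_quadratic (by simp)
  · change (Polynomial.X ^ 3 + Polynomial.C (2 * Complex.I) * Polynomial.X ^ 2 +
      Polynomial.C (-1) * Polynomial.X + Polynomial.C (-Complex.I) : Polynomial ℂ).natDegree = 3
    compute_degree!

theorem eval_polyE_ne_zero (k : Fin 4) {z : ℂ} (hz : 0 ≤ z.im) : (polyE k).eval z ≠ 0 := by
  rw [congrFun (eval_polyE k) z]
  -- The constant `-i` is not Hermite--Biehler and needs its own argument.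
  by_cases hk : k = 0
  · subst hk
    exact (Et_zero z).trans_ne (by simp)
  · refine (isHB_Et ?_).ne_zero hz
    fin_cases k
    · exact absurd rfl hk
    all_goals simp [tPt]

theorem deBrangesSpace_Et (k : Fin 4) : deBrangesSpace (Et (tPt k)) = polySpace k := by
  rw [← eval_polyE, deBrangesSpace_eval fun z => eval_polyE_ne_zero k, natDegree_polyE]

theorem Et_five_eq : Et 5 = E₀ := funext Et_five

theorem tPt_pos {k : Fin 4} (hk : k ≠ 0) : 0 < tPt k := by
  fin_cases k
  · exact absurd rfl hk
  all_goals simp [tPt]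

/-- Across a piece of length `l` on which `D` is constant, `C_b - C_a = -l x D`. Hence `|b|² - |a|²
= -l x D (C_a + C_b) = l x Im (a b)`, which is the criterion with `r = i l z`; here `l = 1/2`. -/
theorem deBrangesNorm_Et_two {p : Polynomial ℂ} (hp : p.natDegree ≤ 1) :
    deBrangesNorm (Et (tPt 2)) (fun z => p.eval z) = deBrangesNorm (Et (tPt 3)) fun z => p.eval z := by
  rw [← eval_polyE, ← eval_polyE]
  refine deBrangesNorm_eval_eq (r := Polynomial.C (Complex.I / 2) * Polynomial.X)
    (fun z => eval_polyE_ne_zero 2) (fun z => eval_polyE_ne_zero 3) ?_ ?_ ?_ fun x => ?_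
  · rw [natDegree_polyE]
    exact Nat.succ_le_succ hp
  · rw [natDegree_polyE]
    exact Nat.succ_le_succ (hp.trans one_le_two)
  · rw [natDegree_polyE, natDegree_polyE]
    have : (Polynomial.C (Complex.I / 2) * Polynomial.X).natDegree ≤ 1 := by
      compute_degree
    change _ ≤ 2 + 3
    omega
  · have h2 : (polyE 2).eval (x : ℂ) = ⟨-x / 2, 2 * x ^ 2 - 1⟩ := by
      rw [congrFun (eval_polyE 2) x]
      refine (Et_nine_halves _).trans (Complex.ext ?_ ?_) <;> simp [← Complex.ofReal_pow]
    have h3 : (polyE 3).eval (x : ℂ) = ⟨x ^ 3 - x, 2 * x ^ 2 - 1⟩ := by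
      rw [congrFun (eval_polyE 3) x]
      refine (Et_five _).trans (Complex.ext ?_ ?_) <;> simp [E₀, ← Complex.ofReal_pow]
    rw [h2, h3, ← Complex.normSq_eq_norm_sq, ← Complex.normSq_eq_norm_sq]
    simp [Complex.normSq_apply]
    ring

/-- Now `C` is constant and `D_b - D_a = l x C`, so the sign is reversed and `r = -i l z` with `l =
4`. -/
theorem deBrangesNorm_Et_one {p : Polynomial ℂ} (hp : p.natDegree ≤ 0) :
    deBrangesNorm (Et (tPt 1)) (fun z => p.eval z) = deBrangesNorm (Et (tPt 2)) fun z => p.eval z := by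
  rw [← eval_polyE, ← eval_polyE]
  refine deBrangesNorm_eval_eq (r := Polynomial.C (-4 * Complex.I) * Polynomial.X)
    (fun z => eval_polyE_ne_zero 1) (fun z => eval_polyE_ne_zero 2) ?_ ?_ ?_ fun x => ?_
  · rw [natDegree_polyE]
    exact Nat.succ_le_succ hp
  · rw [natDegree_polyE]
    exact Nat.succ_le_succ (hp.trans zero_le_one)
  · rw [natDegree_polyE, natDegree_polyE]
    have : (Polynomial.C (-4 * Complex.I) * Polynomial.X).natDegree ≤ 1 := by
      compute_degree
    change _ ≤ 1 + 2
    omega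
  · have h1 : (polyE 1).eval (x : ℂ) = ⟨-x / 2, -1⟩ := by
      rw [congrFun (eval_polyE 1) x]
      refine (Et_half _).trans (Complex.ext ?_ ?_) <;> simp
    have h2 : (polyE 2).eval (x : ℂ) = ⟨-x / 2, 2 * x ^ 2 - 1⟩ := by
      rw [congrFun (eval_polyE 2) x]
      refine (Et_nine_halves _).trans (Complex.ext ?_ ?_) <;> simp [← Complex.ofReal_pow]
    rw [h1, h2, ← Complex.normSq_eq_norm_sq, ← Complex.normSq_eq_norm_sq]
    simp [Complex.normSq_apply]
    ring

theorem deBrangesNorm_Et (k : Fin 4) {f : ℂ → ℂ} (hf : f ∈ deBrangesSpace (Et (tPt k))) :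
    deBrangesNorm (Et (tPt k)) f = deBrangesNorm E₀ f := by
  rw [deBrangesSpace_Et] at hf
  obtain ⟨p, hp, rfl⟩ := mem_polySpace.1 hf
  rcases eq_or_ne p 0 with rfl | hp0
  · simp [deBrangesNorm]
  have hlt := (Polynomial.natDegree_lt_iff_degree_lt hp0).2 hp
  rw [← Et_five_eq, show (5 : ℝ) = tPt 3 from rfl]
  match k, hlt with
  | 0, hlt => exact absurd hlt (by simp)
  | 1, hlt =>
    have h : p.natDegree ≤ 0 := Nat.lt_succ_iff.1 hlt
    exact (deBrangesNorm_Et_one h).trans (deBrangesNorm_Et_two (h.trans zero_le_one))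
  | 2, hlt => exact deBrangesNorm_Et_two (Nat.lt_succ_iff.1 hlt)
  | 3, _ => rfl

/-- Closure under division gives some `polySpace k` with `k ≤ 3`, and nontriviality excludes `k =
0`. The converse is the equality of norms along the chain. -/
theorem isDeBrangesSubspace_E₀_iff (V : Submodule ℂ (ℂ → ℂ)) :
    IsDeBrangesSubspace E₀ V ↔ ∃ k : Fin 4, k ≠ 0 ∧ V = deBrangesSpace (Et (tPt k)) := by
  have hE : deBrangesSpace E₀ = polySpace 3 := by
    rw [← Et_five_eq]
    exact deBrangesSpace_Et 3
  constructor
  · rintro ⟨hle, F, hF, rfl, -⟩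
    rw [hE] at hle
    obtain ⟨k, hk, hV⟩ := exists_eq_polySpace (fun g w hg h => hF.mem_of_mul_sub_mem hg w h) 3 hle
    refine ⟨⟨k, by omega⟩, ?_, hV.trans (deBrangesSpace_Et ⟨k, by omega⟩).symm⟩
    intro h0
    have hk0 : k = 0 := congrArg Fin.val h0
    refine hF.deBrangesSpace_ne_bot ?_
    rw [hV, hk0, eq_bot_iff]
    intro f hf
    obtain ⟨p, hp, rfl⟩ := mem_polySpace.1 hf
    have : p = 0 := by simpa using hp
    subst this
    simp only [Polynomial.eval_zero]
    exact Submodule.zero_mem _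
  · rintro ⟨k, hk, rfl⟩
    refine ⟨?_, _, isHB_Et (tPt_pos hk), rfl, fun f hf => deBrangesNorm_Et k hf⟩
    rw [hE, deBrangesSpace_Et]
    exact polySpace_mono (by omega)

theorem deBrangesSpace_Et_zero : deBrangesSpace (Et (tPt 0)) = ⊥ := by
  rw [deBrangesSpace_Et, eq_bot_iff]
  intro f hf
  obtain ⟨p, hp, rfl⟩ := mem_polySpace.1 hf
  have : p = 0 := by simpa using hp
  subst this
  simp only [Polynomial.eval_zero]
  exact Submodule.zero_mem _

theorem isHB_E₀ : IsHB E₀ := by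
  rw [← Et_five_eq]
  exact isHB_Et (by norm_num)

theorem isStructureHamiltonian_H₀ : IsStructureHamiltonian E₀ 0 5 H₀ := by
  refine ⟨by norm_num, isHamiltonian_H₀ _, limitCircleRight_H₀,
    fun t z => W₀ t z 1 0, fun t z => W₀ t z 1 1, isCanonicalSolution_W₀ _,
    fun z => ⟨partA_E₀ z, partB_E₀ z⟩, fun t ht => isHB_Et ht.1, fun V => ?_,
    tendsto_kernelDiag_W₀⟩
  rw [isDeBrangesSubspace_E₀_iff, regularPoints_H₀ Ioo_subset_Ioc_self Ioc_subset_Icc_self]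
  constructor
  · rintro ⟨k, hk, rfl⟩
    refine ⟨tPt k, ⟨⟨tPt_pos hk, ?_⟩, ?_⟩, rfl⟩ <;> fin_cases k <;> norm_num [tPt]
  · rintro ⟨t, ⟨ht, h⟩, rfl⟩
    simp only [mem_insert_iff, mem_singleton_iff] at h
    rcases h with rfl | rfl | rfl | rfl
    · exact absurd ht.1 (lt_irrefl _)
    · exact ⟨1, by decide, rfl⟩
    · exact ⟨2, by decide, rfl⟩
    · exact ⟨3, by decide, rfl⟩

theorem regularPoints_H₀_Icc : regularPoints H₀ (Icc 0 5) = range tPt := by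
  rw [regularPoints_H₀ Ioo_subset_Icc_self subset_rfl]
  ext t
  simp only [mem_inter_iff, mem_insert_iff, mem_singleton_iff, mem_range]
  constructor
  · rintro ⟨-, rfl | rfl | rfl | rfl⟩
    exacts [⟨0, rfl⟩, ⟨1, rfl⟩, ⟨2, rfl⟩, ⟨3, rfl⟩]
  · rintro ⟨k, rfl⟩
    fin_cases k <;> norm_num [tPt]

end DeBranges

theorem mainTheorem3 :
    -- `H₀` is a Hamiltonian on `[0, 5]`, limit circle at both ends, with the stated indivisible
    -- intervals and regular points
    (IsHamiltonian H₀ (Set.Icc 0 5) ∧ LimitCircleLeft H₀ 0 5 ∧ LimitCircleRight H₀ 0 5 ∧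
      IsIndivisible H₀ (Set.Icc 0 5) 0 (1 / 2) (Real.pi / 2) ∧
      IsIndivisible H₀ (Set.Icc 0 5) (1 / 2) (9 / 2) 0 ∧
      IsIndivisible H₀ (Set.Icc 0 5) (9 / 2) 5 (Real.pi / 2) ∧
      regularPoints H₀ (Set.Icc 0 5) = Set.range tPt) ∧
    -- `E₀` is Hermite--Biehler and `H₀` is its structure Hamiltonian
    (IsHB E₀ ∧ IsStructureHamiltonian E₀ 0 5 H₀) ∧
    -- the explicit matrix is the fundamental solution for `H₀` and has the stated value at `t = 5`
    (IsFundamentalSolution H₀ (Set.Icc 0 5) 0 W₀ ∧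
      (∀ W : ℝ → ℂ → Matrix (Fin 2) (Fin 2) ℂ, IsFundamentalSolution H₀ (Set.Icc 0 5) 0 W →
        ∀ t ∈ Set.Icc (0 : ℝ) 5, ∀ z : ℂ, W t z = W₀ t z) ∧
      (∀ z : ℂ, W₀ 5 z = !![1 - 2 * z ^ 2, 4 * z; z ^ 3 - z, 1 - 2 * z ^ 2])) ∧
    -- the functions `E(t_k, z)`
    (∀ z : ℂ, Et 0 z = -Complex.I ∧ Et (1 / 2) z = -z / 2 - Complex.I ∧
      Et (9 / 2) z = -z / 2 + Complex.I * (2 * z ^ 2 - 1) ∧ Et 5 z = E₀ z) ∧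
    -- the de Branges subspaces of `𝓗(E₀)`, the zero subspace being counted as one, are exactly the
    -- spaces `𝓗(E(t_k, ·))`; these carry the norm of `𝓗(E₀)` and have dimension `k`
    ((∀ V : Submodule ℂ (ℂ → ℂ), (V = ⊥ ∨ IsDeBrangesSubspace E₀ V) ↔
        ∃ k : Fin 4, V = deBrangesSpace (Et (tPt k))) ∧
      (∀ k : Fin 4, ∀ f ∈ deBrangesSpace (Et (tPt k)),
        deBrangesNorm (Et (tPt k)) f = deBrangesNorm E₀ f) ∧
      (∀ k : Fin 4, Module.Finite ℂ (deBrangesSpace (Et (tPt k))) ∧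
        Module.finrank ℂ (deBrangesSpace (Et (tPt k))) = (k : ℕ))) := by
  refine ⟨⟨isHamiltonian_H₀ _, limitCircleLeft_H₀, limitCircleRight_H₀,
      isIndivisible_H₀_pi_div_two (by norm_num) (fun x hx => ⟨hx.1.le, by linarith [hx.2]⟩)
        fun x hx hx' => by linarith [hx.2, hx'.1],
      isIndivisible_H₀_zero (by norm_num)
        (fun x hx => ⟨by linarith [hx.1], by linarith [hx.2]⟩) fun x hx => ⟨hx.1.le, hx.2⟩,
      isIndivisible_H₀_pi_div_two (by norm_num) (fun x hx => ⟨by linarith [hx.1], hx.2.le⟩)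
        fun x hx hx' => by linarith [hx.1, hx'.2],
      regularPoints_H₀_Icc⟩,
    ⟨isHB_E₀, isStructureHamiltonian_H₀⟩,
    ⟨isFundamentalSolution_W₀ _,
      fun W hW t ht z => hW.unique (isFundamentalSolution_W₀ _) z ht, W₀_five⟩,
    fun z => ⟨Et_zero z, Et_half z, Et_nine_halves z, Et_five z⟩,
    fun V => ?_, fun k f hf => deBrangesNorm_Et k hf, fun k => ?_⟩
  · rw [isDeBrangesSubspace_E₀_iff]
    constructor
    · rintro (rfl | ⟨k, -, hk⟩)
      · exact ⟨0, deBrangesSpace_Et_zero.symm⟩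
      · exact ⟨k, hk⟩
    · rintro ⟨k, hk⟩
      rcases eq_or_ne k 0 with rfl | h0
      · exact .inl (hk.trans deBrangesSpace_Et_zero)
      · exact .inr ⟨k, h0, hk⟩
  · rw [deBrangesSpace_Et]
    exact finrank_polySpace k
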